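/- All graphs are finite, connected, nonempty and simple. In the game of Cops and Robber on a graph $G$ with $k$ cops, the cops are first placed on vertices (several may share a vertex), then the robber is placed on a vertex; afterwards the cops and the robber move alternately, the cops first, where in a move each cop (respectively the robber) stays or moves to an adjacent vertex. The cops win if at some moment a cop and the robber occupy the same vertex, and $G$ is $k$-copwin if $k$ cops have a strategy that wins against every play of the robber. Given $G$ and $k\in\mathbb{N}$, the problem Cops and Robber asks whether $G$ is $k$-copwin; it is parameterized by the vertex cover number $\mathsf{vcn}(G)$, the minimum size of a vertex cover of $G$. No vertex cover is given with the input. Theorem. Cops and Robber parameterized by vertex cover number admits a kernel with at most $\mathsf{vcn}+\frac{2^{\mathsf{vcn}}}{\sqrt{\mathsf{vcn}}}$ vertices. That is, there is a polynomial-time algorithm that maps every instance $(G,k)$ to an instance $(G',k')$ of the same problem such that $G$ is $k$-copwin if and only if $G'$ is $k'$-copwin, the size of $(G',k')$ is at most $g(\mathsf{vcn}(G))$ for a computable function $g$, and, whenever $G$ has at least one edge (that is, $\mathsf{vcn}(G)\ge 1$), $$|V(G')|\le \mathsf{vcn}(G)+\frac{2^{\mathsf{vcn}(G)}}{\sqrt{\mathsf{vcn}(G)}}.$$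 -/

import Mathlib

/-! ### The game of Cops and Robber -/

namespace CopsRobber

/-- A player standing on `x` may, in one move, stay on `x` or go along an edge to `y`. -/
def Step {V : Type*} (G : SimpleGraph V) (x y : V) : Prop :=
  x = y ∨ G.Adj x y

/-- `history r i` is the list `[r (i-1), ..., r 1, r 0]` of the first `i` robber positions, the most
recent one first. -/
def history {V : Type*} (r : ℕ → V) : ℕ → List V
  | 0 => []
  | i + 1 => r i :: history r i

/-- A strategy for `k` cops on `G`. `pos []` is the initial placement of the cops, chosen before the
robber is placed, and `pos (v :: h)` is their placement after the cop move that answers the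
robber positions `v :: h` (most recent first, the last entry being the initial one). -/
structure CopStrategy {V : Type*} (G : SimpleGraph V) (k : ℕ) where
  pos : List V → Fin k → V
  legal : ∀ (h : List V) (v : V) (j : Fin k), Step G (pos h j) (pos (v :: h) j)

/-- A play of the robber: an initial vertex `r 0` and then one move at a time. -/
def IsRobberPlay {V : Type*} (G : SimpleGraph V) (r : ℕ → V) : Prop :=
  ∀ i, Step G (r i) (r (i + 1))

/-- At some moment of the play a cop and the robber occupy the same vertex: either when the robber
has just taken its position `r i`, or after the cop move that follows. -/
def Captures {V : Type*} {G : SimpleGraph V} {k : ℕ} (σ : CopStrategy G k) (r : ℕ → V) : Prop :=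
  ∃ (i : ℕ) (j : Fin k), σ.pos (history r i) j = r i ∨ σ.pos (history r (i + 1)) j = r i

/-- `G` is `k`-copwin: `k` cops have a strategy that captures the robber however it plays. -/
def IsCopwin {V : Type*} (G : SimpleGraph V) (k : ℕ) : Prop :=
  ∃ σ : CopStrategy G k, ∀ r : ℕ → V, IsRobberPlay G r → Captures σ r

end CopsRobber

/-! ### A random access machine with a step count

Structured programs for a random access machine whose only arithmetic is addition and truncated
subtraction, under the uniform cost criterion. Since a register grows by at most one bit per
step, a number of steps polynomial in the bit length of the input is the same as polynomial time
on a Turing machine. -/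

namespace RAM

/-- Memory: registers `reg x` and arrays `arr a`, all holding natural numbers. A program is a finite
text, so it names only finitely many registers and arrays. -/
structure State where
  reg : ℕ → ℕ
  arr : ℕ → ℕ → ℕ

/-- Put `v` into register `x`. -/
def State.setReg (s : State) (x v : ℕ) : State :=
  { s with reg := Function.update s.reg x v }

/-- Put `v` into cell `i` of array `a`. -/
def State.setArr (s : State) (a i v : ℕ) : State :=
  { s with arr := Function.update s.arr a (Function.update (s.arr a) i v) }

/-- Programs. Below, `x y z` name registers and `a` names an array. -/
inductive Prog : Type
  | skip : Prog
  /-- `x := c` for a constant `c` -/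
  | const (x c : ℕ) : Prog
  /-- `x := y + z` -/
  | add (x y z : ℕ) : Prog
  /-- `x := y - z`, or `0` if `y < z` -/
  | sub (x y z : ℕ) : Prog
  /-- `x := a[y]` -/
  | load (x a y : ℕ) : Prog
  /-- `a[y] := x` -/
  | store (a y x : ℕ) : Prog
  /-- `p` and then `q` -/
  | seq (p q : Prog) : Prog
  /-- if `x` is nonzero then `p` else `q` -/
  | ite (x : ℕ) (p q : Prog) : Prog
  /-- while `x` is nonzero do `p` -/
  | loop (x : ℕ) (p : Prog) : Prog

/-- `Runs p s t s'`: started in state `s`, the program `p` halts in state `s'` after exactly `t`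
steps; every elementary instruction and every test of a register is one step. -/
inductive Runs : Prog → State → ℕ → State → Prop
  | skip (s : State) : Runs .skip s 1 s
  | const (s : State) (x c : ℕ) : Runs (.const x c) s 1 (s.setReg x c)
  | add (s : State) (x y z : ℕ) : Runs (.add x y z) s 1 (s.setReg x (s.reg y + s.reg z))
  | sub (s : State) (x y z : ℕ) : Runs (.sub x y z) s 1 (s.setReg x (s.reg y - s.reg z))
  | load (s : State) (x a y : ℕ) : Runs (.load x a y) s 1 (s.setReg x (s.arr a (s.reg y)))
  | store (s : State) (a y x : ℕ) : Runs (.store a y x) s 1 (s.setArr a (s.reg y) (s.reg x))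
  | seq {p q : Prog} {s s' s'' : State} {t t' : ℕ} :
      Runs p s t s' → Runs q s' t' s'' → Runs (.seq p q) s (t + t') s''
  | ite_true {x : ℕ} {p q : Prog} {s s' : State} {t : ℕ} :
      s.reg x ≠ 0 → Runs p s t s' → Runs (.ite x p q) s (t + 1) s'
  | ite_false {x : ℕ} {p q : Prog} {s s' : State} {t : ℕ} :
      s.reg x = 0 → Runs q s t s' → Runs (.ite x p q) s (t + 1) s'
  | loop_done {x : ℕ} {p : Prog} {s : State} :
      s.reg x = 0 → Runs (.loop x p) s 1 s
  | loop_step {x : ℕ} {p : Prog} {s s' s'' : State} {t t' : ℕ} :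
      s.reg x ≠ 0 → Runs p s t s' → Runs (.loop x p) s' t' s'' →
        Runs (.loop x p) s (t + t' + 1) s''

/-- The initial state on the input word `w`: the word is in array `0`, its length in register `0`,
and everything else is `0`. -/
def input (w : List ℕ) : State where
  reg x := if x = 0 then w.length else 0
  arr a i := if a = 0 then w.getD i 0 else 0

/-- The state `s` holds the output word `w`: its length is in register `0` and its entries are the
first cells of array `1`. -/
def HasOutput (s : State) (w : List ℕ) : Prop :=
  s.reg 0 = w.length ∧ ∀ i < w.length, s.arr 1 i = w.getD i 0

/-- The length of a word of natural numbers when the entries are written in binary, with a separator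
after each. -/
def bitLength (w : List ℕ) : ℕ :=
  (w.map fun x => Nat.size x + 1).sum

end RAM

/-! ### Parameterized problems and kernelization -/

/-- A parameterized decision problem: instances, their encoding as words of natural numbers, the
yes-instances, and the parameter of an instance. -/
structure ParamProblem where
  Inst : Type
  encode : Inst → List ℕ
  Yes : Inst → Prop
  param : Inst → ℕ

namespace ParamProblem

/-- The size of an instance is the bit length of its encoding. -/
def size (P : ParamProblem) (I : P.Inst) : ℕ :=
  RAM.bitLength (P.encode I)

/-- The map `f` between instances is computed by a program in a number of steps that is polynomial
in the size of the given instance. -/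
def PolyTime (P : ParamProblem) (f : P.Inst → P.Inst) : Prop :=
  ∃ (prog : RAM.Prog) (q : Polynomial ℕ), ∀ I : P.Inst, ∃ (t : ℕ) (s : RAM.State),
    RAM.Runs prog (RAM.input (P.encode I)) t s ∧
      RAM.HasOutput s (P.encode (f I)) ∧ t ≤ q.eval (P.size I)

/-- A kernelization algorithm: a polynomial-time map that sends every instance to an equivalent
instance of the same problem whose size is bounded by a computable function of the parameter. -/
def IsKernelization (P : ParamProblem) (f : P.Inst → P.Inst) : Prop :=
  P.PolyTime f ∧ (∀ I, P.Yes I ↔ P.Yes (f I)) ∧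
    ∃ g : ℕ → ℕ, Computable g ∧ ∀ I, P.size (f I) ≤ g (P.param I)

end ParamProblem

/-! ### Cops and Robber parameterized by the vertex cover number -/

namespace CopsRobber

/-- The vertex cover number of a finite graph, as a natural number. -/
noncomputable def vcn {V : Type*} [Finite V] (G : SimpleGraph V) : ℕ :=
  G.vertexCoverNum.toNat

/-- An instance: a finite connected simple graph with vertices `0, ..., n - 1`, and a number of
cops. -/
structure Instance where
  n : ℕ
  graph : SimpleGraph (Fin n)
  connected : graph.Connected
  k : ℕ

open Classical in
/-- The word `n, k` followed by the adjacency matrix, row by row. -/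
noncomputable def Instance.encode (I : Instance) : List ℕ :=
  I.n :: I.k :: (List.finRange I.n).flatMap fun i =>
    (List.finRange I.n).map fun j => if I.graph.Adj i j then 1 else 0

/-- Cops and Robber (given `G` and `k`, is `G` `k`-copwin?) parameterized by the vertex cover number
of `G`. -/
noncomputable def problemVcn : ParamProblem where
  Inst := Instance
  encode := Instance.encode
  Yes I := IsCopwin I.graph I.k
  param I := vcn I.graph

end CopsRobber

/-!
The kernelization deletes dominated vertices. Call `u` dominated by `v` if `v ≠ u` and every
neighbour of `u` is `v` or a neighbour of `v`. Then sending `u` to `v` and fixing all other vertices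
is a retraction onto the graph without `u`, so a winning strategy of the cops restricts to the
smaller graph. Conversely, cops with a winning strategy on the smaller graph can put a cop on the
robber's shadow, its image under the retraction. If `u` and `v` are adjacent, that cop is on or next
to the robber even after the robber's next move, and catches it. If there are two cops, the cop on
the shadow confines the robber to `u`, and the second cop walks there. So for `k ≥ 2` every
dominated vertex may be deleted, and for `k ≤ 1` every vertex dominated by a neighbour
(`CopsRobber.Dominated.isCopwin_comap_iff`). To replace strategies by positions, the game is first
turned into a backward induction (`CopsRobber.isCopwin_iff_win`).

Once no vertex can be deleted, there are two cases. If `k ≤ 1`, the answer is known: one cop wins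
exactly if a single vertex is left (`CopsRobber.not_isCopwin_one`), and without a cop the robber is
never caught; negative instances are replaced by one vertex with no cop. If `k ≥ 2`, the
neighbourhoods of the vertices outside a minimum vertex cover form an antichain, so with `t` the
vertex cover number Sperner's theorem leaves at most `t + t.choose (t / 2)` vertices
(`CopsRobber.card_le_vcn_add_choose`), and the central binomial coefficient is at most `2 ^ t / √t`
(`CopsRobber.choose_half_le`). Replacing `k` by the minimum of `k` and the number of vertices bounds
the size of the instance.

No vertex cover is needed to find dominated vertices, so the algorithm is a plain search through all
pairs. It is written out as a program for the random access machine and verified by a calculus of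
total correctness with step counts (`RAM.Halts`): `CopsRobber.kernelize` deletes vertices by
overwriting a table of positions, and takes `O(n ^ 4)` steps on a graph with `n` vertices
(`CopsRobber.exists_kernel`).
-/

/-! ### The game as a finite backward induction -/

namespace CopsRobber

section Game

variable {V W : Type*} {G : SimpleGraph V} {H : SimpleGraph W} {k : ℕ}

theorem Step.refl (x : V) : Step G x x := Or.inl rfl

theorem Step.symm {x y : V} (h : Step G x y) : Step G y x :=
  h.imp Eq.symm fun h => h.symm

/-- With the cops on `c`, the robber on `r` and the cops to move, the cops can force a capture
within `n` cop moves. -/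
def WinIn (G : SimpleGraph V) {k : ℕ} : ℕ → (Fin k → V) → V → Prop
  | 0, c, r => ∃ j, c j = r
  | n + 1, c, r => ∃ c' : Fin k → V, (∀ j, Step G (c j) (c' j)) ∧
      ((∃ j, c' j = r) ∨ ∀ r', Step G r r' → WinIn G n c' r')

/-- The cops, to move, can force a capture in a bounded number of moves. -/
def Win (G : SimpleGraph V) {k : ℕ} (c : Fin k → V) (r : V) : Prop :=
  ∃ n, WinIn G n c r

theorem WinIn.succ {n : ℕ} {c : Fin k → V} {r : V} (h : WinIn G n c r) :
    WinIn G (n + 1) c r := by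
  induction n generalizing c r with
  | zero => exact ⟨c, fun j => .refl _, Or.inl h⟩
  | succ n ih =>
    obtain ⟨c', hs, h⟩ := h
    exact ⟨c', hs, h.imp id fun h r' hr => ih (h r' hr)⟩

theorem WinIn.mono {n m : ℕ} (hnm : n ≤ m) {c : Fin k → V} {r : V} (h : WinIn G n c r) :
    WinIn G m c r := by
  induction m, hnm using Nat.le_induction with
  | base => exact h
  | succ m _ ih => exact ih.succ

theorem Win.of_eq {c : Fin k → V} {r : V} (j : Fin k) (h : c j = r) : Win G c r :=
  ⟨0, j, h⟩

/-- Since the robber has only finitely many moves, a cop move after which every answer loses in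
boundedly many moves is itself a winning move within a uniform bound. -/
theorem Win.of_move [Finite V] {c c' : Fin k → V} {r : V} (hs : ∀ j, Step G (c j) (c' j))
    (h : (∃ j, c' j = r) ∨ ∀ r', Step G r r' → Win G c' r') : Win G c r := by
  classical
  cases nonempty_fintype V
  rcases h with h | h
  · exact ⟨1, c', hs, Or.inl h⟩
  · choose! n hn using h
    exact ⟨Finset.univ.sup n + 1, c', hs, Or.inr fun r' hr =>
      (hn r' hr).mono (Finset.le_sup (Finset.mem_univ r'))⟩

/-- One cop can step onto the robber. -/
theorem Win.of_step [Finite V] {c : Fin k → V} {r : V} (j : Fin k) (h : Step G (c j) r) :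
    Win G c r := by
  refine Win.of_move (c' := Function.update c j r) (fun i => ?_) (Or.inl ⟨j, by simp⟩)
  by_cases hi : i = j
  · subst hi; simpa using h
  · simpa [hi] using Step.refl (c i)

/-- From a position that is not winning for the cops, the robber escapes the next cop move. -/
theorem exists_escape [Finite V] {c c' : Fin k → V} {r : V} (hs : ∀ j, Step G (c j) (c' j))
    (h : ¬ Win G c r) : (∀ j, c' j ≠ r) ∧ ∃ r', Step G r r' ∧ ¬ Win G c' r' := by
  constructor
  · exact fun j hj => h (Win.of_move hs (Or.inl ⟨j, hj⟩))
  · by_contra! hc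
    exact h (Win.of_move hs (Or.inr hc))

open Classical in
/-- The memoryless answer of the cops to the position `c, r`: a move that shortens the game if the
position is winning, and staying put otherwise. -/
noncomputable def respond (G : SimpleGraph V) {k : ℕ} (c : Fin k → V) (r : V) : Fin k → V :=
  if h : ∃ n, WinIn G (n + 1) c r then (Nat.find_spec h).choose else c

theorem respond_step (c : Fin k → V) (r : V) (j : Fin k) : Step G (c j) (respond G c r j) := by
  classical
  unfold respond
  split_ifs with h
  · exact (Nat.find_spec h).choose_spec.1 j
  · exact .refl _

theorem respond_spec {n : ℕ} {c : Fin k → V} {r : V} (h : WinIn G (n + 1) c r) :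
    (∃ j, respond G c r j = r) ∨
      ∃ m ≤ n, ∀ r', Step G r r' → WinIn G m (respond G c r) r' := by
  classical
  have h' : ∃ n, WinIn G (n + 1) c r := ⟨n, h⟩
  have := (Nat.find_spec h').choose_spec.2
  unfold respond
  rw [dif_pos h']
  exact this.imp id fun hw => ⟨_, Nat.find_min' h' h, hw⟩

/-- Strategies that see the whole history win exactly when some placement wins the backward
induction against every placement of the robber. -/
theorem isCopwin_iff_win [Finite V] :
    IsCopwin G k ↔ ∃ c : Fin k → V, ∀ r, Win G c r := by
  constructor
  · rintro ⟨σ, hσ⟩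
    refine ⟨σ.pos [], fun r₀ => ?_⟩
    by_contra hr₀
    have next : ∀ p : {p : List V × V // ¬ Win G (σ.pos p.1) p.2},
        ∃ r', Step G p.1.2 r' ∧ ¬ Win G (σ.pos (p.1.2 :: p.1.1)) r' := fun p =>
      (exists_escape (σ.legal _ _) p.2).2
    choose nxt hstep hnot using next
    -- `q i` is the history before the `i`-th position of the robber, together with that position.
    let q : ℕ → {p : List V × V // ¬ Win G (σ.pos p.1) p.2} := fun i =>
      Nat.rec ⟨([], r₀), hr₀⟩ (fun _ p => ⟨(p.1.2 :: p.1.1, nxt p), hnot p⟩) i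
    have hq : ∀ i, (q i).1.1 = history (fun i => (q i).1.2) i := by
      intro i
      induction i with
      | zero => rfl
      | succ i ih => change (q i).1.2 :: (q i).1.1 = _; rw [ih]; rfl
    obtain ⟨i, j, h⟩ := hσ (fun i => (q i).1.2) fun i => hstep (q i)
    have hi := (q i).2
    rcases h with h | h
    · rw [← hq] at h
      exact hi (Win.of_eq j h)
    · refine (exists_escape (σ.legal _ (q i).1.2) hi).1 j ?_
      simpa only [history, ← hq] using h
  · rintro ⟨c, hc⟩
    let p : List V → Fin k → V := fun h => List.rec c (fun v _ c' => respond G c' v) h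
    refine ⟨⟨p, fun h v j => respond_step _ _ j⟩, fun r hr => ?_⟩
    have key : ∀ n i, WinIn G n (p (history r i)) (r i) →
        Captures (G := G) ⟨p, fun h v j => respond_step _ _ j⟩ r := by
      intro n
      induction n using Nat.strong_induction_on with
      | _ n ih =>
        intro i h
        cases n with
        | zero => obtain ⟨j, hj⟩ := h; exact ⟨i, j, Or.inl hj⟩
        | succ n =>
          rcases respond_spec h with ⟨j, hj⟩ | ⟨m, hm, hw⟩
          · exact ⟨i, j, Or.inr hj⟩
          · exact ih m (by omega) (i + 1) (hw _ (hr i))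
    obtain ⟨n, hn⟩ := hc (r 0)
    exact key n 0 hn

theorem not_isCopwin_zero [Finite V] [Nonempty V] : ¬ IsCopwin G 0 := by
  rw [isCopwin_iff_win]
  rintro ⟨c, hc⟩
  have key : ∀ n (c : Fin 0 → V) r, ¬ WinIn G n c r := by
    intro n
    induction n with
    | zero => rintro c r ⟨j, -⟩; exact j.elim0
    | succ n ih =>
      rintro c r ⟨c', -, ⟨j, -⟩ | h⟩
      · exact j.elim0
      · exact ih c' r (h r (.refl r))
  obtain ⟨n, hn⟩ := hc (Classical.arbitrary V)
  exact key n c _ hn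

/-- Enough cops to occupy every vertex win. -/
theorem isCopwin_of_card_le {m : ℕ} {G : SimpleGraph (Fin m)} [Nonempty (Fin m)] (h : m ≤ k) :
    IsCopwin G k := by
  rw [isCopwin_iff_win]
  refine ⟨fun j => if hj : j.1 < m then ⟨j, hj⟩ else Classical.arbitrary _, fun r => ?_⟩
  exact Win.of_eq ⟨r, r.2.trans_le h⟩ (by simp)

theorem isCopwin_min_iff {m : ℕ} {G : SimpleGraph (Fin m)} [Nonempty (Fin m)] :
    IsCopwin G (min k m) ↔ IsCopwin G k := by
  rcases le_total k m with h | h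
  · rw [min_eq_left h]
  · exact ⟨fun _ => isCopwin_of_card_le h, fun _ => isCopwin_of_card_le (le_min h le_rfl)⟩

/-- If no vertex is dominated by a neighbour, a single cop does not catch the robber: it never
steps next to the robber without the robber having a safe vertex. -/
theorem not_isCopwin_one [Finite V] [Nontrivial V]
    (h : ∀ u v, G.Adj u v → ∃ w, G.Adj u w ∧ ¬ Step G v w) : ¬ IsCopwin G 1 := by
  rw [isCopwin_iff_win]
  rintro ⟨c, hc⟩
  have key : ∀ n (c : Fin 1 → V) r, WinIn G n c r → Step G (c 0) r := by
    intro n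
    induction n with
    | zero => rintro c r ⟨j, hj⟩; rw [Subsingleton.elim 0 j]; exact Or.inl hj
    | succ n ih =>
      rintro c r ⟨c', hs, ⟨j, hj⟩ | hw⟩
      · rw [Subsingleton.elim 0 j, ← hj]; exact hs j
      · rcases ih c' r (hw r (.refl r)) with he | ha
        · rw [← he]; exact hs 0
        · obtain ⟨w, hw₁, hw₂⟩ := h r (c' 0) ha.symm
          exact (hw₂ (ih c' w (hw w (Or.inr hw₁)))).elim
  have hall : ∀ r, Step G (c 0) r := fun r => by
    obtain ⟨n, hn⟩ := hc r
    exact key n c r hn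
  obtain ⟨r, hr⟩ := exists_ne (c 0)
  obtain ⟨w, -, hw⟩ := h r (c 0) (((hall r).resolve_left hr.symm).symm)
  exact hw (hall w)

/-! ### Deleting a dominated vertex -/

/-- `H` is `G` with the vertex `u` deleted, where every neighbour of `u` is `v` or a neighbour of
`v`: `incl` embeds `H` into `G`, and `retr` sends `u` to `v` and fixes all other vertices. -/
structure Deletion (G : SimpleGraph V) (H : SimpleGraph W) (u v : V) where
  incl : W → V
  retr : V → W
  incl_step : ∀ {x y}, Step H x y → Step G (incl x) (incl y)
  retr_step : ∀ {x y}, Step G x y → Step H (retr x) (retr y)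
  retr_incl : ∀ x, retr (incl x) = x
  incl_retr : ∀ x, x ≠ u → incl (retr x) = x
  incl_retr_self : incl (retr u) = v

namespace Deletion

variable {u v : V} (D : Deletion G H u v)

include D

theorem connected (hG : G.Connected) : H.Connected := by
  have := hG.nonempty
  have hreach : ∀ x y, G.Reachable x y → H.Reachable (D.retr x) (D.retr y) := by
    rintro x y ⟨p⟩
    induction p with
    | nil => exact .refl _
    | cons h p ih =>
      rcases D.retr_step (Or.inr h) with he | ha
      · rw [he]; exact ih
      · exact ha.reachable.trans ih
  have : Nonempty W := this.map D.retr
  refine SimpleGraph.Connected.mk fun x y => ?_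
  simpa only [D.retr_incl] using hreach _ _ (hG.preconnected (D.incl x) (D.incl y))

/-- The retraction carries a winning strategy on `G` to the smaller graph. -/
theorem isCopwin_of_isCopwin (h : IsCopwin G k) : IsCopwin H k := by
  obtain ⟨σ, hσ⟩ := h
  refine ⟨⟨fun h j => D.retr (σ.pos (h.map D.incl) j), fun h x j => ?_⟩, fun r hr => ?_⟩
  · exact D.retr_step (σ.legal _ _ j)
  · have hh : ∀ i, (history r i).map D.incl = history (fun i => D.incl (r i)) i := by
      intro i
      induction i with
      | zero => rfl
      | succ i ih => simp only [history, List.map_cons, ih]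
    obtain ⟨i, j, h⟩ := hσ (fun i => D.incl (r i)) fun i => D.incl_step (hr i)
    refine ⟨i, j, ?_⟩
    simp only [hh]
    exact h.imp (fun h => by rw [h, D.retr_incl]) fun h => by rw [h, D.retr_incl]

/-- The cops of `G` play a winning strategy against the robber's shadow in `H`. It suffices that
they win as soon as one of them can step onto the shadow. -/
theorem win_of_win [Finite V] {c : Fin k → W} {r : V}
    (hshadow : ∀ (c : Fin k → V) r j, Step G (c j) (D.incl (D.retr r)) → Win G c r)
    (h : Win H c (D.retr r)) : Win G (fun j => D.incl (c j)) r := by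
  obtain ⟨n, hn⟩ := h
  induction n generalizing c r with
  | zero =>
    obtain ⟨j, hj⟩ := hn
    exact hshadow _ r j (by rw [hj]; exact .refl _)
  | succ n ih =>
    obtain ⟨c', hs, ⟨j, hj⟩ | hw⟩ := hn
    · refine hshadow _ r j ?_
      rw [← hj]
      exact D.incl_step (hs j)
    · exact Win.of_move (fun j => D.incl_step (hs j)) (Or.inr fun r' hr =>
        ih (hw _ (D.retr_step hr)))

theorem isCopwin_iff_of_shadow [Finite V] [Finite W]
    (hshadow : ∀ (c : Fin k → V) r j, Step G (c j) (D.incl (D.retr r)) → Win G c r) :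
    IsCopwin G k ↔ IsCopwin H k := by
  refine ⟨D.isCopwin_of_isCopwin, ?_⟩
  rw [isCopwin_iff_win, isCopwin_iff_win]
  rintro ⟨c, hc⟩
  exact ⟨_, fun r => D.win_of_win hshadow (hc _)⟩

omit D in
theorem step_update {c : Fin k → V} {j : Fin k} {x : V} (h : Step G (c j) x) (i : Fin k) :
    Step G (c i) (Function.update c j x i) := by
  by_cases hi : i = j
  · subst hi; simpa using h
  · simpa [hi] using Step.refl (c i)

/-- If `v` is a neighbour of `u`, a cop on the shadow catches the robber with its next move. -/
theorem isCopwin_iff_of_adj [Finite V] [Finite W] (huv : G.Adj u v) :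
    IsCopwin G k ↔ IsCopwin H k := by
  refine D.isCopwin_iff_of_shadow fun c r j hj => ?_
  refine Win.of_move (step_update hj) ?_
  by_cases hr : r = u
  · subst hr
    refine Or.inr fun r' hr' => Win.of_step j ?_
    rw [Function.update_self]
    by_cases h : r' = r
    · rw [h, D.incl_retr_self]; exact Or.inr huv.symm
    · simpa only [D.incl_retr r' h] using D.incl_step (D.retr_step hr')
  · exact Or.inl ⟨j, by rw [Function.update_self, D.incl_retr r hr]⟩

/-- A cop that has reached the shadow confines the robber to `u`, where a second cop catches
it. -/
theorem isCopwin_iff_of_two_le [Finite V] [Finite W] (hG : G.Connected) (hk : 2 ≤ k) :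
    IsCopwin G k ↔ IsCopwin H k := by
  refine D.isCopwin_iff_of_shadow fun c r j hj => ?_
  have : Nontrivial (Fin k) := Fin.nontrivial_iff_two_le.2 hk
  obtain ⟨i, hij⟩ := exists_ne j
  have key : ∀ {x z} (p : G.Walk x z) (c : Fin k → V) (r : V), u = z → c i = x →
      Step G (c j) (D.incl (D.retr r)) → Win G c r := by
    intro x z p
    induction p with
    | nil =>
      intro c r hu hc hs
      refine Win.of_move (step_update hs) (Or.inl ?_)
      by_cases hr : r = u
      · exact ⟨i, by rw [Function.update_of_ne hij, hc, hr, hu]⟩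
      · exact ⟨j, by rw [Function.update_self, D.incl_retr r hr]⟩
    | @cons x y _ hxy p ih =>
      intro c r hu hc hs
      have hs' : Step G (Function.update c j (D.incl (D.retr r)) i) y := by
        rw [Function.update_of_ne hij, hc]; exact Or.inr hxy
      refine Win.of_move (c' := Function.update (Function.update c j (D.incl (D.retr r))) i y)
        (fun l => ?_) (Or.inr fun r' hr' => ih _ r' hu (by simp) ?_)
      · by_cases hl : l = i
        · subst hl
          simpa [Function.update_of_ne hij] using hs'
        · rw [Function.update_of_ne hl]; exact step_update hs l
      · rw [Function.update_of_ne hij.symm, Function.update_self]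
        exact D.incl_step (D.retr_step hr')
  obtain ⟨p⟩ := hG.preconnected (c i) u
  exact key p c r rfl rfl hj

end Deletion

end Game

section Reduction

variable {V W : Type*} {G : SimpleGraph V} {k : ℕ}

/-- `v ≠ u` and every neighbour of `u` is `v` or a neighbour of `v`. -/
def Dominated (G : SimpleGraph V) (u v : V) : Prop :=
  u ≠ v ∧ ∀ w, G.Adj u w → Step G v w

/-- An embedding whose image misses only the dominated vertex `u` exhibits the deletion of `u`. -/
theorem Dominated.nonempty_deletion {u v : V} (h : Dominated G u v) {e : W → V}
    (he : Function.Injective e) (hrange : ∀ x, x ≠ u ↔ x ∈ Set.range e) :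
    Nonempty (Deletion G (G.comap e) u v) := by
  classical
  have hpre : ∀ x, ∃ y, e y = if x = u then v else x := fun x => by
    split_ifs with hx
    · exact (hrange v).1 h.1.symm
    · exact (hrange x).1 hx
  choose ρ hρ using hpre
  have hstep : ∀ {x y}, Step (G.comap e) x y ↔ Step G (e x) (e y) := by
    intro x y
    simp [Step, he.eq_iff]
  refine ⟨⟨e, ρ, fun hxy => hstep.1 hxy, fun {x y} hxy => ?_, fun x => ?_, fun x hx => ?_, ?_⟩⟩
  · rw [hstep, hρ, hρ]
    rcases hxy with rfl | hxy
    · exact .refl _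
    split_ifs with hx hy hy
    · exact .refl _
    · subst hx; exact h.2 y hxy
    · subst hy; exact (h.2 x hxy.symm).symm
    · exact Or.inr hxy
  · apply he
    rw [hρ, if_neg ((hrange (e x)).2 ⟨x, rfl⟩)]
  · rw [hρ, if_neg hx]
  · rw [hρ, if_pos rfl]

/-- The two deletion rules: with two cops or more any dominated vertex may be deleted, and with any
number of cops a vertex dominated by a neighbour. -/
theorem Dominated.isCopwin_comap_iff [Finite V] [Finite W] {u v : V} (h : Dominated G u v)
    (hG : G.Connected) (hk : k ≤ 1 → G.Adj u v) {e : W → V}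
    (he : Function.Injective e) (hrange : ∀ x, x ≠ u ↔ x ∈ Set.range e) :
    (G.comap e).Connected ∧ (IsCopwin G k ↔ IsCopwin (G.comap e) k) := by
  obtain ⟨D⟩ := h.nonempty_deletion he hrange
  refine ⟨D.connected hG, ?_⟩
  rcases le_or_gt k 1 with h1 | h2
  · exact D.isCopwin_iff_of_adj (hk h1)
  · exact D.isCopwin_iff_of_two_le hG h2

/-! ### The number of vertices of a reduced graph -/

/-- Without dominated vertices, the neighbourhoods of the vertices outside a vertex cover form an
antichain, so Sperner's theorem bounds their number. -/
theorem card_le_vcn_add_choose [Finite V] [Finite W] {e : W → V} (he : Function.Injective e)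
    (h : ∀ u v, ¬ Dominated (G.comap e) u v) :
    Nat.card W ≤ vcn G + (vcn G).choose (vcn G / 2) := by
  classical
  cases nonempty_fintype V
  cases nonempty_fintype W
  obtain ⟨C, hC, hcov⟩ := G.vertexCoverNum_exists
  have hcard : C.toFinset.card = vcn G := by
    rw [vcn, ← hC, Set.encard_eq_coe_toFinset_card, ENat.toNat_natCast]
  let nbr : W → Finset C := fun x => Finset.univ.filter fun y => G.Adj (e x) y
  let S : Finset W := Finset.univ.filter fun x => e x ∉ C
  have hmono : ∀ x ∈ S, ∀ y, nbr x ⊆ nbr y → x = y := by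
    intro x hx y hxy
    by_contra hne
    refine h x y ⟨hne, fun w hw => Or.inr ?_⟩
    have hwC : e w ∈ C := (hcov hw).resolve_left (by simpa [S] using hx)
    have : (⟨e w, hwC⟩ : C) ∈ nbr y := hxy (by simpa [nbr] using hw)
    simpa [nbr] using this
  have hinj : Set.InjOn nbr S := fun x hx y _ hxy => hmono x hx y hxy.subset
  have hanti : IsAntichain (· ⊆ ·) ((S.image nbr : Finset (Finset C)) : Set (Finset C)) := by
    rintro _ hx _ hy hne hsub
    obtain ⟨x, hxS, rfl⟩ := Finset.mem_image.1 (Finset.mem_coe.1 hx)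
    obtain ⟨y, -, rfl⟩ := Finset.mem_image.1 (Finset.mem_coe.1 hy)
    exact hne (congrArg nbr (hmono x hxS y hsub))
  have hS := hanti.sperner
  rw [Finset.card_image_of_injOn hinj, ← Set.toFinset_card, hcard] at hS
  have hT : (Finset.univ.filter fun x => e x ∈ C).card ≤ vcn G := by
    rw [← hcard]
    exact Finset.card_le_card_of_injOn e (fun x hx => by simpa using hx) he.injOn
  rw [Nat.card_eq_fintype_card, ← Finset.card_univ,
    ← Finset.card_filter_add_card_filter_not (fun x => e x ∈ C)]
  exact Nat.add_le_add hT hS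

/-- The factor `2 * n + 1`, rather than the `2 * n` that the bound on `choose` needs, is what makes the
induction go through. -/
theorem two_mul_add_one_mul_centralBinom_sq_le (n : ℕ) :
    (2 * n + 1) * n.centralBinom ^ 2 ≤ 16 ^ n := by
  induction n with
  | zero => simp
  | succ n ih =>
    have h := Nat.succ_mul_centralBinom_succ n
    refine Nat.le_of_mul_le_mul_left ?_ (show 0 < (n + 1) ^ 2 by positivity)
    calc (n + 1) ^ 2 * ((2 * (n + 1) + 1) * (n + 1).centralBinom ^ 2)
        = (2 * n + 3) * ((n + 1) * (n + 1).centralBinom) ^ 2 := by ring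
      _ = (4 * ((2 * n + 3) * (2 * n + 1))) * ((2 * n + 1) * n.centralBinom ^ 2) := by
          rw [h]; ring
      _ ≤ (16 * (n + 1) ^ 2) * 16 ^ n := Nat.mul_le_mul (by nlinarith) ih
      _ = (n + 1) ^ 2 * 16 ^ (n + 1) := by ring

theorem mul_choose_half_sq_le (t : ℕ) : t * t.choose (t / 2) ^ 2 ≤ 4 ^ t := by
  obtain ⟨n, rfl | rfl⟩ := t.even_or_odd'
  · have h := two_mul_add_one_mul_centralBinom_sq_le n
    rw [Nat.centralBinom_eq_two_mul_choose] at h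
    rw [Nat.mul_div_cancel_left n two_pos, pow_mul]
    norm_num
    nlinarith
  · have h := two_mul_add_one_mul_centralBinom_sq_le (n + 1)
    have hc : (n + 1).centralBinom = 2 * (2 * n + 1).choose n := by
      rw [Nat.centralBinom_eq_two_mul_choose, show 2 * (n + 1) = 2 * n + 1 + 1 by ring,
        Nat.choose_succ_succ, Nat.choose_symm_half]
      ring
    rw [hc] at h
    have h4 : 4 * 4 ^ (2 * n + 1) = 16 ^ (n + 1) := by
      rw [← pow_succ', show 2 * n + 1 + 1 = 2 * (n + 1) by ring, pow_mul]
      norm_num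
    rw [show (2 * n + 1) / 2 = n by omega]
    rw [← h4] at h
    nlinarith

theorem choose_half_le {t : ℕ} (ht : 1 ≤ t) :
    (t.choose (t / 2) : ℝ) ≤ 2 ^ t / Real.sqrt t := by
  have h : (t : ℝ) * (t.choose (t / 2) : ℝ) ^ 2 ≤ 4 ^ t := by exact_mod_cast mul_choose_half_sq_le t
  rw [le_div_iff₀ (Real.sqrt_pos.2 (by exact_mod_cast ht))]
  refine abs_le_of_sq_le_sq' ?_ (by positivity) |>.2
  rw [mul_pow, Real.sq_sqrt (by positivity), ← pow_mul, mul_comm t 2, pow_mul]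
  norm_num
  linarith

/-- A computable bound on the size of an encoded instance in terms of the vertex cover number. -/
def sizeBound (t : ℕ) : ℕ :=
  2 * (t + 2 ^ t) * (t + 2 ^ t) + 2 * (t + 2 ^ t) + 2

theorem computable_sizeBound : Computable sizeBound := by
  have hpow : Primrec fun t : ℕ => 2 ^ t := by
    refine (Primrec.nat_rec₁ 1 (Primrec.nat_mul.comp Primrec.snd (Primrec.const 2)).to₂).of_eq
      fun t => ?_
    induction t with
    | zero => rfl
    | succ t ih => simp only [pow_succ, ← ih]
  have hs : Primrec fun t : ℕ => t + 2 ^ t := Primrec.nat_add.comp Primrec.id hpow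
  have h2 : Primrec fun t : ℕ => 2 * (t + 2 ^ t) := Primrec.nat_mul.comp (Primrec.const 2) hs
  exact (Primrec.nat_add.comp (Primrec.nat_add.comp (Primrec.nat_mul.comp h2 hs) h2)
    (Primrec.const 2)).to_comp

/-! ### The encoding of an instance -/

theorem getD_flatMap {α : Type*} (l : List α) (g : α → List ℕ) {n : ℕ}
    (hg : ∀ a, (g a).length = n) {x y : ℕ} (hx : x < l.length) (hy : y < n) :
    (l.flatMap g).getD (x * n + y) 0 = (g l[x]).getD y 0 := by
  induction l generalizing x with
  | nil => simp at hx
  | cons a l ih =>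
    rw [List.flatMap_cons]
    cases x with
    | zero => rw [Nat.zero_mul, Nat.zero_add, List.getD_append _ _ _ _ (by rw [hg]; exact hy)]; rfl
    | succ x =>
      have : (x + 1) * n + y = (g a).length + (x * n + y) := by rw [hg]; ring
      rw [List.getD_append_right _ _ _ _ (by omega), this, Nat.add_sub_cancel_left,
        ih (by simpa using hx)]
      rfl

theorem Instance.length_encode (I : Instance) : I.encode.length = I.n * I.n + 2 := by
  simp [encode, List.length_flatMap]

open Classical in
theorem Instance.getD_encode (I : Instance) (x y : Fin I.n) :
    I.encode.getD (2 + (x * I.n + y)) 0 = if I.graph.Adj x y then 1 else 0 := by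
  have h := getD_flatMap (List.finRange I.n)
    (fun i => (List.finRange I.n).map fun j => if I.graph.Adj i j then 1 else 0) (n := I.n)
    (by simp) (x := x) (y := y) (by simp) y.2
  rw [encode, Nat.add_comm 2, List.getD_cons_succ, List.getD_cons_succ]
  convert h using 1
  simp [List.getD_eq_getElem?_getD]

theorem size_le_self (x : ℕ) : x.size ≤ x :=
  Nat.size_le.2 Nat.lt_two_pow_self

open Classical in
theorem Instance.size_le (I : Instance) (hk : I.k ≤ I.n) :
    problemVcn.size I ≤ 2 * I.n * I.n + 2 * I.n + 2 := by
  have hbit : ∀ w : List ℕ, (∀ x ∈ w, x ≤ 1) → RAM.bitLength w ≤ 2 * w.length := by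
    intro w hw
    have := List.sum_le_card_nsmul (w.map fun x => Nat.size x + 1) 2 (by
      intro y hy
      obtain ⟨x, hx, rfl⟩ := List.mem_map.1 hy
      have := (size_le_self x).trans (hw x hx)
      omega)
    rw [List.length_map, smul_eq_mul, mul_comm] at this
    exact this
  have hlen := I.length_encode
  rw [encode, List.length_cons, List.length_cons] at hlen
  have hM := hbit ((List.finRange I.n).flatMap fun i =>
    (List.finRange I.n).map fun j => if I.graph.Adj i j then 1 else 0) (by
      intro x hx
      obtain ⟨i, -, hx⟩ := List.mem_flatMap.1 hx
      obtain ⟨j, -, rfl⟩ := List.mem_map.1 hx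
      split_ifs <;> omega)
  have h1 := size_le_self I.n
  have h2 := size_le_self I.k
  change RAM.bitLength I.encode ≤ _
  rw [encode]
  unfold RAM.bitLength at hM ⊢
  rw [List.map_cons, List.map_cons, List.sum_cons, List.sum_cons]
  have : 2 * I.n * I.n = 2 * (I.n * I.n) := by ring
  omega

theorem Instance.length_le_size (I : Instance) : I.encode.length ≤ problemVcn.size I := by
  have : ∀ w : List ℕ, w.length ≤ RAM.bitLength w := by
    intro w
    induction w with
    | nil => exact le_rfl
    | cons a w ih => simp only [RAM.bitLength, List.map_cons, List.sum_cons, List.length_cons] at *; omega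
  exact this _

end Reduction

end CopsRobber

/-! ### Reasoning about programs -/

namespace RAM

@[simp] theorem State.setReg_reg (s : State) (x v y : ℕ) :
    (s.setReg x v).reg y = if y = x then v else s.reg y := by
  simp [State.setReg, Function.update_apply]

@[simp] theorem State.setReg_arr (s : State) (x v : ℕ) : (s.setReg x v).arr = s.arr := rfl

@[simp] theorem State.setArr_reg (s : State) (a i v : ℕ) : (s.setArr a i v).reg = s.reg := rfl

@[simp] theorem State.setArr_arr (s : State) (a i v b : ℕ) :
    (s.setArr a i v).arr b = if b = a then Function.update (s.arr a) i v else s.arr b := by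
  simp [State.setArr, Function.update_apply]

/-- Total correctness with a step count: from `s`, the program `p` halts in a state `s'` after `t`
steps such that `Q s' t`. -/
def Halts (p : Prog) (s : State) (Q : State → ℕ → Prop) : Prop :=
  ∃ t s', Runs p s t s' ∧ Q s' t

variable {p q : Prog} {s : State} {Q : State → ℕ → Prop}

theorem Halts.imp {Q' : State → ℕ → Prop} (h : Halts p s Q) (hQ : ∀ s' t, Q s' t → Q' s' t) :
    Halts p s Q' := by
  obtain ⟨t, s', hr, h⟩ := h
  exact ⟨t, s', hr, hQ _ _ h⟩

@[simp] theorem halts_skip : Halts .skip s Q ↔ Q s 1 :=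
  ⟨by rintro ⟨_, _, ⟨⟩, h⟩; exact h, fun h => ⟨_, _, .skip s, h⟩⟩

@[simp] theorem halts_const {x c : ℕ} : Halts (.const x c) s Q ↔ Q (s.setReg x c) 1 :=
  ⟨by rintro ⟨_, _, ⟨⟩, h⟩; exact h, fun h => ⟨_, _, .const s x c, h⟩⟩

@[simp] theorem halts_add {x y z : ℕ} :
    Halts (.add x y z) s Q ↔ Q (s.setReg x (s.reg y + s.reg z)) 1 :=
  ⟨by rintro ⟨_, _, ⟨⟩, h⟩; exact h, fun h => ⟨_, _, .add s x y z, h⟩⟩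

@[simp] theorem halts_sub {x y z : ℕ} :
    Halts (.sub x y z) s Q ↔ Q (s.setReg x (s.reg y - s.reg z)) 1 :=
  ⟨by rintro ⟨_, _, ⟨⟩, h⟩; exact h, fun h => ⟨_, _, .sub s x y z, h⟩⟩

@[simp] theorem halts_load {x a y : ℕ} :
    Halts (.load x a y) s Q ↔ Q (s.setReg x (s.arr a (s.reg y))) 1 :=
  ⟨by rintro ⟨_, _, ⟨⟩, h⟩; exact h, fun h => ⟨_, _, .load s x a y, h⟩⟩

@[simp] theorem halts_store {a y x : ℕ} :
    Halts (.store a y x) s Q ↔ Q (s.setArr a (s.reg y) (s.reg x)) 1 :=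
  ⟨by rintro ⟨_, _, ⟨⟩, h⟩; exact h, fun h => ⟨_, _, .store s a y x, h⟩⟩

@[simp] theorem halts_ite {x : ℕ} : Halts (.ite x p q) s Q ↔
    if s.reg x = 0 then Halts q s (fun s' t => Q s' (t + 1))
    else Halts p s (fun s' t => Q s' (t + 1)) := by
  constructor
  · rintro ⟨_, _, hr, h⟩
    cases hr with
    | ite_true hx hr => rw [if_neg hx]; exact ⟨_, _, hr, h⟩
    | ite_false hx hr => rw [if_pos hx]; exact ⟨_, _, hr, h⟩
  · split_ifs with hx
    · rintro ⟨_, _, hr, h⟩; exact ⟨_, _, .ite_false hx hr, h⟩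
    · rintro ⟨_, _, hr, h⟩; exact ⟨_, _, .ite_true hx hr, h⟩

theorem halts_seq : Halts (.seq p q) s Q ↔
    Halts p s fun s₁ t₁ => Halts q s₁ fun s₂ t₂ => Q s₂ (t₁ + t₂) := by
  constructor
  · rintro ⟨_, _, hr, h⟩
    cases hr with
    | seq h₁ h₂ => exact ⟨_, _, h₁, _, _, h₂, h⟩
  · rintro ⟨_, _, h₁, _, _, h₂, h⟩
    exact ⟨_, _, .seq h₁ h₂, h⟩

/-- Run the programs of a list one after the other. -/
def block : List Prog → Prog
  | [] => .skip
  | p :: ps => .seq p (block ps)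

@[simp] theorem halts_block_nil : Halts (block []) s Q ↔ Q s 1 := halts_skip

@[simp] theorem halts_block_cons {ps : List Prog} : Halts (block (p :: ps)) s Q ↔
    Halts p s fun s₁ t₁ => Halts (block ps) s₁ fun s₂ t₂ => Q s₂ (t₁ + t₂) := halts_seq

/-- A loop halts if every pass through its body decreases the index of the invariant. -/
theorem halts_loop {x T : ℕ} {Inv : ℕ → State → Prop}
    (h : ∀ i s, Inv i s → s.reg x ≠ 0 → Halts p s fun s' t => t ≤ T ∧ ∃ j < i, Inv j s')
    (i : ℕ) (hs : Inv i s) :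
    Halts (.loop x p) s fun s' t =>
      t ≤ (i + 1) * (T + 1) ∧ s'.reg x = 0 ∧ ∃ j ≤ i, Inv j s' := by
  induction i using Nat.strong_induction_on generalizing s with
  | _ i ih =>
    by_cases hx : s.reg x = 0
    · exact ⟨1, s, .loop_done hx, Nat.mul_pos (by omega) (by omega), hx, i, le_rfl, hs⟩
    · obtain ⟨t, s', hr, ht, j, hj, hs'⟩ := h i s hs hx
      obtain ⟨t', s'', hr', ht', hx', l, hl, hs''⟩ := ih j hj hs'
      refine ⟨_, _, .loop_step hx hr hr', ?_, hx', l, by omega, hs''⟩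
      have : (j + 2) * (T + 1) ≤ (i + 1) * (T + 1) := Nat.mul_le_mul_right _ (by omega)
      have : (j + 2) * (T + 1) = (j + 1) * (T + 1) + (T + 1) := by ring
      omega

/-- Run `p` with register `x` one less each time, down to `0`. Register `1` is to hold the
number `1`. -/
def countdown (x : ℕ) (p : Prog) : Prog :=
  .loop x (.seq (.sub x x 1) p)

theorem halts_countdown {x T : ℕ} {Inv : ℕ → State → Prop}
    (hreg : ∀ i s, Inv i s → s.reg x = i ∧ s.reg 1 = 1) {m : ℕ}
    (h : ∀ i < m, ∀ s, Inv (i + 1) s → Halts p (s.setReg x i) fun s' t => t ≤ T ∧ Inv i s')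
    (hs : Inv m s) :
    Halts (countdown x p) s fun s' t => t ≤ (m + 1) * (T + 2) ∧ Inv 0 s' := by
  have hl := halts_loop (x := x) (p := .seq (.sub x x 1) p) (T := T + 1)
    (Inv := fun i s => i ≤ m ∧ Inv i s) (fun i s hi hx => by
      obtain ⟨him, hi⟩ := hi
      obtain ⟨hxi, h1⟩ := hreg i s hi
      obtain _ | i := i
      · exact (hx hxi).elim
      · rw [halts_seq, halts_sub, hxi, h1, Nat.add_sub_cancel]
        exact (h i him s hi).imp fun s' t ht => ⟨by omega, i, by omega, by omega, ht.2⟩)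
    m ⟨le_rfl, hs⟩
  refine hl.imp ?_
  rintro s' t ⟨ht, hx, j, -, -, hj⟩
  obtain rfl : 0 = j := hx.symm.trans (hreg j s' hj).1
  exact ⟨ht, hj⟩

end RAM

/-! ### The search for a removable vertex -/

namespace CopsRobber

open RAM

/-- The data structure of the program for the current induced subgraph, with `m` vertices at
positions `0, ..., m - 1`: array `0` is the input word `A`, and the bit for the positions `i` and
`j` is its entry at `R i + C j`, with the row addresses `R` in array `3` and the column offsets
`C` in array `2`. Register `5` is `k - 1`, and the registers `1` and `6` hold the constants `1`
and `0`. -/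
structure Ctx (A C R : ℕ → ℕ) (k m : ℕ) (s : State) : Prop where
  reg_one : s.reg 1 = 1
  reg_k : s.reg 3 = k
  reg_m : s.reg 4 = m
  reg_pred : s.reg 5 = k - 1
  reg_zero : s.reg 6 = 0
  arr_input : s.arr 0 = A
  arr_col : s.arr 2 = C
  arr_row : s.arr 3 = R

variable {A C R : ℕ → ℕ} {k m : ℕ} {s : State}

theorem Ctx.setReg (h : Ctx A C R k m s) {x v : ℕ} (hx : 7 ≤ x) :
    Ctx A C R k m (s.setReg x v) := by
  refine ⟨?_, ?_, ?_, ?_, ?_, h.arr_input, h.arr_col, h.arr_row⟩ <;>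
    rw [State.setReg_reg, if_neg (by omega)]
  exacts [h.reg_one, h.reg_k, h.reg_m, h.reg_pred, h.reg_zero]

/-- The states agree except for the scratch registers, which are those from `20` on. -/
def Agree (s s' : State) : Prop :=
  (∀ x < 20, s'.reg x = s.reg x) ∧ s'.arr = s.arr

theorem Agree.setReg {s' : State} (h : Agree s s') {x v : ℕ} (hx : 20 ≤ x) :
    Agree s (s'.setReg x v) :=
  ⟨fun y hy => by rw [State.setReg_reg, if_neg (by omega), h.1 y hy], h.2⟩

theorem Agree.refl (s : State) : Agree s s := ⟨fun _ _ => rfl, rfl⟩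

theorem Ctx.agree (h : Ctx A C R k m s) {s' : State} (ha : Agree s s') : Ctx A C R k m s' := by
  refine ⟨?_, ?_, ?_, ?_, ?_, by rw [ha.2, h.arr_input], by rw [ha.2, h.arr_col],
    by rw [ha.2, h.arr_row]⟩ <;> rw [ha.1 _ (by omega)]
  exacts [h.reg_one, h.reg_k, h.reg_m, h.reg_pred, h.reg_zero]

/-- Read the bit for the positions in the registers `i` and `j` into register `24`. -/
def lookup (i j : ℕ) : Prog :=
  block [.load 20 3 i, .load 21 2 j, .add 22 20 21, .load 24 0 22]

/-- The bit for the positions `i` and `j`. -/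
def bit (A C R : ℕ → ℕ) (i j : ℕ) : ℕ := A (R i + C j)

theorem halts_lookup (h : Ctx A C R k m s) {i j : ℕ} (hj : j < 20) {Q : State → ℕ → Prop}
    (hQ : ∀ s', Agree s s' → s'.reg 24 = bit A C R (s.reg i) (s.reg j) → Q s' 5) :
    Halts (lookup i j) s Q := by
  simp only [lookup, halts_block_cons, halts_block_nil, halts_load, halts_add]
  refine hQ _ ?_ ?_
  · exact ((((Agree.refl s).setReg (by omega)).setReg (by omega)).setReg (by omega)).setReg
      (by omega)
  · have : j ≠ 20 := by omega
    simp [h.arr_input, h.arr_row, h.arr_col, bit, this]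

/-- Set register `22` to a nonzero value exactly if the registers `i` and `j` differ. -/
def differ (i j : ℕ) : Prog :=
  block [.sub 22 i j, .sub 23 j i, .add 22 22 23]

theorem halts_differ {i j : ℕ} (hi : i < 20) (hj : j < 20) {Q : State → ℕ → Prop}
    (hQ : ∀ s', Agree s s' → (s'.reg 22 = 0 ↔ s.reg i = s.reg j) → Q s' 4) :
    Halts (differ i j) s Q := by
  simp only [differ, halts_block_cons, halts_block_nil, halts_sub, halts_add]
  refine hQ _ ?_ ?_
  · exact (((Agree.refl s).setReg (by omega)).setReg (by omega)).setReg (by omega)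
  · have : i ≠ 22 := by omega
    have : j ≠ 22 := by omega
    simp [*]
    omega

/-- The test of the deletion rule at the level of positions: `u` is dominated by `v`, which for
`k ≤ 1` has to be adjacent to `u`. -/
def Removable (A C R : ℕ → ℕ) (k m u v : ℕ) : Prop :=
  u ≠ v ∧ (k - 1 = 0 → bit A C R u v ≠ 0) ∧
    ∀ w < m, bit A C R u w ≠ 0 → bit A C R v w ≠ 0 ∨ w = v

/-- Clear register `14` if the position in register `13` is a neighbour of the one in register `11`,
but neither equal to nor a neighbour of the one in register `12`. -/
def checkNeighbour : Prog :=
  block [lookup 11 13, .ite 24 (block [lookup 12 13,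
    .ite 24 .skip (block [differ 13 12, .ite 22 (.const 14 0) .skip])]) .skip]

/-- Set register `14` to a nonzero value exactly if the positions in the registers `11` and `12`
differ. -/
def checkDistinct : Prog :=
  block [.const 14 1, differ 11 12, .ite 22 .skip (.const 14 0)]

/-- If register `5` is zero, clear register `14` unless the positions in the registers `11` and `12`
are adjacent. -/
def checkAdjacent : Prog :=
  .ite 5 .skip (block [lookup 11 12, .ite 24 .skip (.const 14 0)])

/-- Set register `14` to a nonzero value exactly if the position in register `11` may be deleted
because of the position in register `12`. -/
def checkPair : Prog :=
  block [checkDistinct, checkAdjacent, .add 13 4 6, countdown 13 checkNeighbour]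

/-- What the pair test keeps: the data structure, the two positions, and the registers `10` and
`15` with the outcome of the search so far. -/
structure Kept (A C R : ℕ → ℕ) (k m : ℕ) (s s' : State) : Prop where
  ctx : Ctx A C R k m s'
  reg10 : s'.reg 10 = s.reg 10
  reg11 : s'.reg 11 = s.reg 11
  reg12 : s'.reg 12 = s.reg 12
  reg15 : s'.reg 15 = s.reg 15

theorem Kept.setReg {s' : State} (h : Kept A C R k m s s') {x w : ℕ} (hx : 13 ≤ x) (hx' : x ≠ 15) :
    Kept A C R k m s (s'.setReg x w) := by
  refine ⟨h.ctx.setReg (by omega), ?_, ?_, ?_, ?_⟩ <;> rw [State.setReg_reg, if_neg (by omega)]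
  exacts [h.reg10, h.reg11, h.reg12, h.reg15]

theorem Kept.agree {s' s'' : State} (h : Kept A C R k m s s') (ha : Agree s' s'') :
    Kept A C R k m s s'' := by
  refine ⟨h.ctx.agree ha, ?_, ?_, ?_, ?_⟩ <;> rw [ha.1 _ (by omega)]
  exacts [h.reg10, h.reg11, h.reg12, h.reg15]

theorem halts_checkNeighbour {s' : State} (h : Kept A C R k m s s') :
    Halts checkNeighbour s' fun s'' t => t ≤ 30 ∧ Kept A C R k m s s'' ∧ s''.reg 13 = s'.reg 13 ∧
      (s''.reg 14 ≠ 0 ↔ s'.reg 14 ≠ 0 ∧ (bit A C R (s.reg 11) (s'.reg 13) ≠ 0 →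
        bit A C R (s.reg 12) (s'.reg 13) ≠ 0 ∨ s'.reg 13 = s.reg 12)) := by
  rw [checkNeighbour, halts_block_cons]
  refine halts_lookup h.ctx (by omega) fun s₁ ha₁ hb₁ => ?_
  have h₁ := h.agree ha₁
  rw [h.reg11] at hb₁
  rw [halts_block_cons, halts_ite]
  split_ifs with hz₁
  · rw [hb₁] at hz₁
    simp only [halts_skip, halts_block_nil]
    refine ⟨by omega, h₁, ha₁.1 _ (by omega), ?_⟩
    rw [ha₁.1 _ (by omega)]
    simp [hz₁]
  rw [hb₁] at hz₁
  rw [halts_block_cons]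
  refine halts_lookup h₁.ctx (by omega) fun s₂ ha₂ hb₂ => ?_
  have h₂ := h₁.agree ha₂
  rw [h₁.reg12, ha₁.1 _ (by omega)] at hb₂
  rw [halts_block_cons, halts_ite]
  split_ifs with hz₂
  · rw [hb₂] at hz₂
    rw [halts_block_cons]
    refine halts_differ (by omega) (by omega) fun s₃ ha₃ hb₃ => ?_
    have h₃ := h₂.agree ha₃
    rw [h₂.reg12, ha₂.1 _ (by omega), ha₁.1 _ (by omega)] at hb₃
    simp only [halts_block_cons, halts_block_nil, halts_ite, halts_const, halts_skip]
    split_ifs with hz₃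
    · refine ⟨by omega, h₃, ?_, ?_⟩ <;>
        rw [ha₃.1 _ (by omega), ha₂.1 _ (by omega), ha₁.1 _ (by omega)]
      simp [hb₃.1 hz₃]
    · refine ⟨by omega, h₃.setReg (by omega) (by omega), ?_, ?_⟩
      · rw [State.setReg_reg, if_neg (by omega), ha₃.1 _ (by omega), ha₂.1 _ (by omega),
          ha₁.1 _ (by omega)]
      · rw [hb₃] at hz₃
        simp [hz₁, hz₂, hz₃]
  · rw [hb₂] at hz₂
    simp only [halts_skip, halts_block_nil]
    refine ⟨by omega, h₂, ?_, ?_⟩ <;> rw [ha₂.1 _ (by omega), ha₁.1 _ (by omega)]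
    simp [hz₂]

theorem halts_checkDistinct (h : Ctx A C R k m s) :
    Halts checkDistinct s fun s' t => t ≤ 10 ∧ Kept A C R k m s s' ∧
      (s'.reg 14 ≠ 0 ↔ s.reg 11 ≠ s.reg 12) := by
  have hK : Kept A C R k m s (s.setReg 14 1) := Kept.setReg ⟨h, rfl, rfl, rfl, rfl⟩ (by omega)
    (by omega)
  simp only [checkDistinct, halts_block_cons, halts_const]
  refine halts_differ (by omega) (by omega) fun s₁ ha₁ hb₁ => ?_
  have h₁ := hK.agree ha₁
  rw [hK.reg11, hK.reg12] at hb₁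
  have h14 : s₁.reg 14 = 1 := by rw [ha₁.1 _ (by omega)]; simp
  simp only [halts_ite, halts_const, halts_skip, halts_block_nil]
  split_ifs with hz
  · exact ⟨by omega, h₁.setReg (by omega) (by omega), by simp [hb₁.1 hz]⟩
  · exact ⟨by omega, h₁, by rw [h14]; simpa [hb₁] using hz⟩

theorem halts_checkAdjacent {s' : State} (h : Kept A C R k m s s') :
    Halts checkAdjacent s' fun s'' t => t ≤ 10 ∧ Kept A C R k m s s'' ∧
      (s''.reg 14 ≠ 0 ↔
        s'.reg 14 ≠ 0 ∧ (k - 1 = 0 → bit A C R (s.reg 11) (s.reg 12) ≠ 0)) := by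
  rw [checkAdjacent, halts_ite, h.ctx.reg_pred]
  split_ifs with hk
  · rw [halts_block_cons]
    refine halts_lookup h.ctx (by omega) fun s₁ ha₁ hb₁ => ?_
    rw [h.reg11, h.reg12] at hb₁
    have h₁ := h.agree ha₁
    simp only [halts_block_cons, halts_block_nil, halts_ite, halts_const, halts_skip]
    rw [hb₁]
    split_ifs with hz
    · refine ⟨by omega, h₁.setReg (by omega) (by omega), ?_⟩
      simp [hz, hk]
    · refine ⟨by omega, h₁, ?_⟩
      rw [ha₁.1 _ (by omega)]
      simp [hz]
  · rw [halts_skip]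
    exact ⟨by omega, h, by simp [hk]⟩

theorem halts_checkPair (h : Ctx A C R k m s) :
    Halts checkPair s fun s' t => t ≤ 100 * (m + 1) ∧ Kept A C R k m s s' ∧
      (s'.reg 14 ≠ 0 ↔ Removable A C R k m (s.reg 11) (s.reg 12)) := by
  rw [checkPair, halts_block_cons]
  refine (halts_checkDistinct h).imp ?_
  rintro s₁ t₁ ⟨ht₁, h₁, h14₁⟩
  rw [halts_block_cons]
  refine (halts_checkAdjacent h₁).imp ?_
  rintro s₂ t₂ ⟨ht₂, h₂, h14₂⟩
  rw [h14₁] at h14₂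
  simp only [halts_block_cons, halts_add, halts_block_nil]
  refine (halts_countdown (Inv := fun i s' => Kept A C R k m s s' ∧ s'.reg 13 = i ∧
    (s'.reg 14 ≠ 0 ↔ (s.reg 11 ≠ s.reg 12 ∧ (k - 1 = 0 → bit A C R (s.reg 11) (s.reg 12) ≠ 0)) ∧
      ∀ w, i ≤ w → w < m → bit A C R (s.reg 11) w ≠ 0 →
        bit A C R (s.reg 12) w ≠ 0 ∨ w = s.reg 12)) (T := 30)
    (fun i s' hi => ⟨hi.2.1, hi.1.ctx.reg_one⟩) (m := m) ?_
    ⟨h₂.setReg (by omega) (by omega), ?_, ?_⟩).imp ?_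
  · rintro i hi s' ⟨hs', -, h14⟩
    refine (halts_checkNeighbour (hs'.setReg (x := 13) (w := i) (by omega) (by omega))).imp ?_
    rintro s'' t ⟨ht, hK, h13', h14'⟩
    simp only [State.setReg_reg, reduceIte, Nat.reduceEqDiff] at h13' h14'
    refine ⟨ht, hK, h13', ?_⟩
    rw [h14', h14, and_assoc]
    refine and_congr_right fun _ => ⟨fun hw w hiw hwm => ?_, fun hw => ⟨fun w hiw hwm =>
      hw w (by omega) hwm, hw i le_rfl hi⟩⟩
    rcases hiw.eq_or_lt with rfl | hiw
    · exact hw.2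
    · exact hw.1 w hiw hwm
  · simp [h₂.ctx.reg_m, h₂.ctx.reg_zero]
  · rw [State.setReg_reg, if_neg (by omega), h14₂]
    exact ⟨fun h => ⟨h, fun w h1 h2 => by omega⟩, fun h => h.1⟩
  · rintro s' t ⟨ht, hs', -, h14⟩
    refine ⟨by omega, hs', h14.trans ?_⟩
    simp only [Removable, Nat.zero_le, true_implies, and_assoc]

/-- Search all pairs of positions for a removable one. Register `10` tells whether one was found, and
then register `15` holds the position that may be deleted. -/
def scan : Prog :=
  block [.const 10 0, .add 11 4 6, countdown 11 (block [.add 12 4 6, countdown 12 (block [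
    checkPair, .ite 14 (block [.const 10 1, .add 15 11 6]) .skip])])]

/-- The outcome of a search through the pairs that satisfy `P`. -/
def Outcome (A C R : ℕ → ℕ) (k m : ℕ) (P : ℕ → ℕ → Prop) (s : State) : Prop :=
  (s.reg 10 ≠ 0 → s.reg 15 < m ∧ ∃ v < m, Removable A C R k m (s.reg 15) v) ∧
    (s.reg 10 = 0 → ∀ u < m, ∀ v < m, P u v → ¬ Removable A C R k m u v)

theorem Outcome.mono {P P' : ℕ → ℕ → Prop} (h : Outcome A C R k m P s)
    (hP : ∀ u < m, ∀ v < m, P' u v → P u v) : Outcome A C R k m P' s :=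
  ⟨h.1, fun h0 u hu v hv hp => h.2 h0 u hu v hv (hP u hu v hv hp)⟩

theorem Outcome.congr {P : ℕ → ℕ → Prop} (h : Outcome A C R k m P s) {s' : State}
    (h10 : s'.reg 10 = s.reg 10) (h15 : s'.reg 15 = s.reg 15) : Outcome A C R k m P s' := by
  rw [Outcome, h10, h15]; exact h

theorem halts_scanRow (h : Ctx A C R k m s) {u : ℕ} (hu : u < m) (h11 : s.reg 11 = u)
    (ho : Outcome A C R k m (fun u' _ => u < u') s) :
    Halts (block [.add 12 4 6, countdown 12 (block [
      checkPair, .ite 14 (block [.const 10 1, .add 15 11 6]) .skip])]) s fun s' t =>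
        t ≤ 200 * (m + 1) ^ 2 ∧ Ctx A C R k m s' ∧ s'.reg 11 = u ∧
          Outcome A C R k m (fun u' _ => u ≤ u') s' := by
  simp only [halts_block_cons, halts_add, halts_block_nil]
  refine (halts_countdown (Inv := fun i s' => Ctx A C R k m s' ∧ s'.reg 11 = u ∧ s'.reg 12 = i ∧
    Outcome A C R k m (fun u' v => u < u' ∨ u' = u ∧ i ≤ v) s') (T := 100 * (m + 1) + 10)
    (fun i s' hi => ⟨hi.2.2.1, hi.1.reg_one⟩) (m := m) ?_
    ⟨h.setReg (by omega), ?_, ?_, ?_⟩).imp ?_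
  · rintro v hv s₀ ⟨hs₀, h11₀, -, ho₀⟩
    rw [halts_block_cons]
    refine (halts_checkPair (hs₀.setReg (x := 12) (v := v) (by omega))).imp ?_
    rintro s₁ t₁ ⟨ht₁, h₁, h14⟩
    have h11' := h₁.reg11
    have h12' := h₁.reg12
    have h10' := h₁.reg10
    have h15' := h₁.reg15
    simp only [State.setReg_reg, reduceIte, Nat.reduceEqDiff] at h14 h11' h12' h10' h15'
    rw [h11₀] at h14 h11'
    simp only [halts_ite, halts_block_cons, halts_const, halts_add, halts_block_nil, halts_skip]
    split_ifs with hz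
    · refine ⟨by omega, h₁.ctx, h11', h12', fun h0 => ?_, fun h0 u' hu' v' hv' hP => ?_⟩
      · rw [h10'] at h0
        rw [h15']
        exact ho₀.1 h0
      · rw [h10'] at h0
        by_cases hc : u' = u ∧ v' = v
        · rw [hc.1, hc.2, ← h14]
          exact not_not.2 hz
        · exact ho₀.2 h0 u' hu' v' hv' (by omega)
    · refine ⟨by omega, (h₁.ctx.setReg (by omega)).setReg (by omega), by simpa using h11',
        by simpa using h12', fun _ => ?_, fun h0 => ?_⟩
      · simp only [State.setReg_reg, reduceIte, Nat.reduceEqDiff, h11', h₁.ctx.reg_zero]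
        exact ⟨hu, v, hv, h14.1 hz⟩
      · simp at h0
  · simpa using h11
  · simp [h.reg_m, h.reg_zero]
  · exact (ho.mono fun u' hu' v hv hP => by omega).congr (by simp) (by simp)
  · rintro s' t ⟨ht, hs', h11', -, ho'⟩
    refine ⟨?_, hs', h11', ho'.mono fun u' hu' v hv hP => by omega⟩
    nlinarith

theorem halts_scan (h : Ctx A C R k m s) :
    Halts scan s fun s' t => t ≤ 300 * (m + 1) ^ 3 ∧ Ctx A C R k m s' ∧
      Outcome A C R k m (fun _ _ => True) s' := by
  rw [scan, halts_block_cons, halts_const, halts_block_cons, halts_add, halts_block_cons]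
  refine (halts_countdown (Inv := fun i s' => Ctx A C R k m s' ∧ s'.reg 11 = i ∧
    Outcome A C R k m (fun u _ => i ≤ u) s') (T := 200 * (m + 1) ^ 2)
    (fun i s' hi => ⟨hi.2.1, hi.1.reg_one⟩) (m := m) ?_
    ⟨(h.setReg (by omega)).setReg (by omega), ?_, ?_, ?_⟩).imp ?_
  · rintro u hu s₀ ⟨hs₀, -, ho₀⟩
    refine (halts_scanRow (hs₀.setReg (x := 11) (v := u) (by omega)) hu (by simp)
      (ho₀.congr (by simp) (by simp))).imp ?_
    exact fun s' t h => h
  · simp [h.reg_m, h.reg_zero]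
  · simp
  · exact fun _ u hu v hv hP => absurd hP (by omega)
  · rintro s' t ⟨ht, hs', -, ho'⟩
    rw [halts_block_nil]
    refine ⟨?_, hs', ho'.mono fun u hu v hv hP => Nat.zero_le u⟩
    have h1 : m + 1 ≤ (m + 1) ^ 3 := Nat.le_self_pow (by omega) _
    have h2 : (m + 1) * (200 * (m + 1) ^ 2 + 2) = 200 * (m + 1) ^ 3 + 2 * (m + 1) := by ring
    omega

/-- Delete the position in register `15` by moving the last position there. -/
def delete : Prog :=
  block [.sub 4 4 1, .load 22 3 4, .store 3 15 22, .load 22 2 4, .store 2 15 22]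

theorem halts_delete (h : Ctx A C R k (m + 1) s) : Halts delete s fun s' t => t ≤ 6 ∧
    Ctx A (Function.update C (s.reg 15) (C m)) (Function.update R (s.reg 15) (R m)) k m s' ∧
      s'.reg 10 = s.reg 10 := by
  simp only [delete, halts_block_cons, halts_block_nil, halts_sub, halts_load, halts_store]
  refine ⟨by omega, ⟨?_, ?_, ?_, ?_, ?_, ?_, ?_, ?_⟩, ?_⟩ <;>
    simp [h.reg_one, h.reg_k, h.reg_m, h.reg_pred, h.reg_zero, h.arr_input, h.arr_col, h.arr_row]

/-! ### Exhaustive deletion of vertices -/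

/-- Set up the data structure for the whole input graph. -/
def setup : Prog :=
  block [.const 1 1, .load 2 0 6, .load 3 0 1, .add 4 2 6, .sub 5 3 1, .add 20 0 6, .add 11 2 6,
    countdown 11 (block [.sub 20 20 2, .store 3 11 20, .store 2 11 11])]

theorem halts_setup (I : Instance) :
    Halts setup (RAM.input I.encode) fun s t => t ≤ 50 * (I.n + 1) ∧
      ∃ C R, Ctx (fun i => I.encode.getD i 0) C R I.k I.n s ∧
        ∀ i < I.n, C i = i ∧ R i = 2 + i * I.n := by
  simp only [setup, halts_block_cons, halts_block_nil, halts_const, halts_load, halts_add,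
    halts_sub]
  refine (halts_countdown (Inv := fun i s => ∃ C R,
    Ctx (fun i => I.encode.getD i 0) C R I.k I.n s ∧ s.reg 2 = I.n ∧ s.reg 11 = i ∧
      s.reg 20 = 2 + i * I.n ∧ ∀ j < I.n, i ≤ j → C j = j ∧ R j = 2 + j * I.n) (T := 10)
    (fun i s ⟨_, _, hi⟩ => ⟨hi.2.2.1, hi.1.reg_one⟩) (m := I.n) ?_ ?_).imp ?_
  · rintro i hi s ⟨C, R, h, h2, -, h20, hCR⟩
    simp only [halts_block_cons, halts_block_nil, halts_sub, halts_store]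
    refine ⟨by omega, Function.update C i i, Function.update R i (2 + i * I.n),
      ⟨?_, ?_, ?_, ?_, ?_, ?_, ?_, ?_⟩, ?_, ?_, ?_, fun j hj hij => ?_⟩
    · simp [h.reg_one]
    · simp [h.reg_k]
    · simp [h.reg_m]
    · simp [h.reg_pred]
    · simp [h.reg_zero]
    · simp [h.arr_input]
    · simp [h.arr_col]
    · simp [h.arr_row, h20, h2, Nat.succ_mul, ← Nat.add_assoc]
    · simp [h2]
    · simp
    · simp [h20, h2, Nat.succ_mul, ← Nat.add_assoc]
    · rcases hij.eq_or_lt with rfl | hij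
      · simp
      · rw [Function.update_of_ne hij.ne', Function.update_of_ne hij.ne']
        exact hCR j hj hij
  · have hlen := I.length_encode
    have h0 : I.encode.getD 0 0 = I.n := rfl
    have h1 : I.encode.getD 1 0 = I.k := rfl
    refine ⟨fun _ => 0, fun _ => 0, ⟨?_, ?_, ?_, ?_, ?_, ?_, ?_, ?_⟩, ?_, ?_, ?_,
      fun j hj hij => by omega⟩ <;> simp [RAM.input, h0, h1, hlen, -List.getD_eq_getElem?_getD]
    omega
  · rintro s t ⟨ht, C, R, h, -, -, -, hCR⟩
    exact ⟨by omega, C, R, h, fun i hi => hCR i hi (Nat.zero_le i)⟩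

/-- Delete vertices by the deletion rules as long as possible. -/
def reduce : Prog :=
  block [.const 10 1, .loop 10 (block [scan, .ite 10 delete .skip])]

/-- The arrays `C` and `R` describe the subgraph of `I.graph` induced by the vertices `e i`. -/
structure Represents (I : Instance) {m : ℕ} (e : Fin m → Fin I.n) (C R : ℕ → ℕ) : Prop where
  inj : Function.Injective e
  col : ∀ i : Fin m, C i = e i
  row : ∀ i : Fin m, R i = 2 + e i * I.n

namespace Represents

variable {I : Instance} {e : Fin m → Fin I.n}

open Classical in
theorem bit_eq (h : Represents I e C R) (i j : Fin m) :
    bit (fun i => I.encode.getD i 0) C R i j = if (I.graph.comap e).Adj i j then 1 else 0 := by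
  rw [bit, h.row, h.col, Nat.add_assoc, I.getD_encode]
  simp only [SimpleGraph.comap_adj]

theorem bit_ne_zero_iff (h : Represents I e C R) (i j : Fin m) :
    bit (fun i => I.encode.getD i 0) C R i j ≠ 0 ↔ (I.graph.comap e).Adj i j := by
  classical
  rw [h.bit_eq]
  split_ifs with ha <;> simpa using ha

theorem removable_iff (h : Represents I e C R) (u v : Fin m) :
    Removable (fun i => I.encode.getD i 0) C R k m u v ↔
      Dominated (I.graph.comap e) u v ∧ (k ≤ 1 → (I.graph.comap e).Adj u v) := by
  have hw : (∀ w < m, bit (fun i => I.encode.getD i 0) C R u w ≠ 0 →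
      bit (fun i => I.encode.getD i 0) C R v w ≠ 0 ∨ w = v) ↔
      ∀ w, (I.graph.comap e).Adj u w → Step (I.graph.comap e) v w := by
    rw [Fin.forall_iff]
    refine forall₂_congr fun w hw => ?_
    have h1 := h.bit_ne_zero_iff u ⟨w, hw⟩
    have h2 := h.bit_ne_zero_iff v ⟨w, hw⟩
    simp only at h1 h2
    rw [h1, h2, Step, Fin.ext_iff, or_comm, eq_comm]
  rw [Removable, hw, h.bit_ne_zero_iff, Dominated, ne_eq, Fin.val_inj, and_assoc,
    and_congr_right_iff]
  intro _
  rw [show k - 1 = 0 ↔ k ≤ 1 by omega, and_comm]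

/-- Moving the last position to the position `u` deletes a removable vertex. -/
theorem delete {e : Fin (m + 1) → Fin I.n} (h : Represents I e C R) {u v : Fin (m + 1)}
    (hG : (I.graph.comap e).Connected)
    (hr : Removable (fun i => I.encode.getD i 0) C R k (m + 1) u v) :
    ∃ e' : Fin m → Fin I.n,
      Represents I e' (Function.update C u (C m)) (Function.update R u (R m)) ∧
        (I.graph.comap e').Connected ∧
          (IsCopwin (I.graph.comap e) k ↔ IsCopwin (I.graph.comap e') k) := by
  obtain ⟨hd, hadj⟩ := (h.removable_iff u v).1 hr
  -- `c i` is the position from which the entry at `i` comes.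
  let c : Fin m → Fin (m + 1) := fun i => if i.castSucc = u then Fin.last m else i.castSucc
  have hc : Function.Injective c := by
    intro i j hij
    have hi := Fin.castSucc_ne_last i
    have hj := Fin.castSucc_ne_last j
    apply Fin.castSucc_injective
    simp only [c] at hij
    split_ifs at hij with h1 h2 h2
    · rw [h1, h2]
    · exact (hj hij.symm).elim
    · exact (hi hij).elim
    · exact hij
  have hrange : ∀ x, x ≠ u ↔ x ∈ Set.range c := by
    intro x
    constructor
    · intro hx
      rcases Fin.eq_castSucc_or_eq_last x with ⟨i, rfl⟩ | rfl
      · exact ⟨i, if_neg hx⟩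
      · rcases Fin.eq_castSucc_or_eq_last u with ⟨i, rfl⟩ | rfl
        · exact ⟨i, if_pos rfl⟩
        · exact (hx rfl).elim
    · rintro ⟨i, rfl⟩ hu
      simp only [c] at hu
      split_ifs at hu with h1
      · exact Fin.castSucc_ne_last i (h1.trans hu.symm)
      · exact h1 hu
  obtain ⟨hconn, hiff⟩ := hd.isCopwin_comap_iff (k := k) hG hadj hc hrange
  have hval : ∀ (F : ℕ → ℕ) (i : Fin m), Function.update F u (F m) i = F (c i) := by
    intro F i
    simp only [c]
    split_ifs with h1
    · rw [← h1]; simp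
    · rw [Function.update_of_ne]
      · rfl
      · exact fun h2 => h1 (Fin.ext h2)
  exact ⟨e ∘ c, ⟨h.inj.comp hc, fun i => (hval C i).trans (h.col _),
    fun i => (hval R i).trans (h.row _)⟩, hconn, hiff⟩

end Represents

theorem halts_reduce {I : Instance} {C R : ℕ → ℕ}
    (h : Ctx (fun i => I.encode.getD i 0) C R I.k I.n s)
    (hCR : ∀ i < I.n, C i = i ∧ R i = 2 + i * I.n) :
    Halts reduce s fun s' t => t ≤ 1000 * (I.n + 2) ^ 4 ∧
      ∃ (m : ℕ) (C R : ℕ → ℕ) (e : Fin m → Fin I.n),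
        Ctx (fun i => I.encode.getD i 0) C R I.k m s' ∧ Represents I e C R ∧
        (I.graph.comap e).Connected ∧
        (IsCopwin I.graph I.k ↔ IsCopwin (I.graph.comap e) I.k) ∧
        ∀ u v, ¬ (Dominated (I.graph.comap e) u v ∧
          (I.k ≤ 1 → (I.graph.comap e).Adj u v)) := by
  rw [reduce, halts_block_cons, halts_const, halts_block_cons]
  -- The index counts the vertices that are left, and one more pass while the flag is set: a pass
  -- either deletes a vertex or clears the flag.
  refine (halts_loop (T := 300 * (I.n + 1) ^ 3 + 10) (Inv := fun j s' =>
    ∃ (m : ℕ) (C R : ℕ → ℕ) (e : Fin m → Fin I.n), m + (if s'.reg 10 = 0 then 0 else 1) = j ∧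
        Ctx (fun i => I.encode.getD i 0) C R I.k m s' ∧ Represents I e C R ∧
        (I.graph.comap e).Connected ∧
        (IsCopwin I.graph I.k ↔ IsCopwin (I.graph.comap e) I.k) ∧
        (s'.reg 10 = 0 → ∀ u v, ¬ (Dominated (I.graph.comap e) u v ∧
          (I.k ≤ 1 → (I.graph.comap e).Adj u v)))) ?_ (I.n + 1) ?_).imp ?_
  · rintro j s ⟨m, C, R, e, hj, hs, hrep, hconn, hiff, -⟩ h10
    rw [if_neg h10] at hj
    have hmn : m ≤ I.n := by simpa using Fintype.card_le_of_injective e hrep.inj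
    have htime : 300 * (m + 1) ^ 3 ≤ 300 * (I.n + 1) ^ 3 := by gcongr
    rw [halts_block_cons]
    refine (halts_scan hs).imp ?_
    rintro s₁ t₁ ⟨ht₁, h₁, ho⟩
    rw [halts_block_cons, halts_ite]
    split_ifs with hz
    · rw [halts_skip, halts_block_nil]
      refine ⟨by omega, m, by omega, m, C, R, e, by simp [hz], h₁, hrep, hconn, hiff,
        fun _ u v => ?_⟩
      rw [← hrep.removable_iff]
      exact ho.2 hz u u.2 v v.2 trivial
    · obtain ⟨hu, v, hv, hr⟩ := ho.1 hz
      obtain _ | m := m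
      · omega
      obtain ⟨e', hrep', hconn', hiff'⟩ := hrep.delete (u := ⟨s₁.reg 15, hu⟩) (v := ⟨v, hv⟩) hconn hr
      refine (halts_delete h₁).imp ?_
      rintro s₂ t₂ ⟨ht₂, h₂, h10₂⟩
      rw [halts_block_nil]
      refine ⟨by omega, m + 1, by omega, m, _, _, e', ?_, h₂, hrep', hconn', hiff.trans hiff',
        fun h0 => (hz (h10₂ ▸ h0)).elim⟩
      rw [h10₂, if_neg hz]
  · exact ⟨I.n, C, R, id, by simp, h.setReg (by omega), ⟨Function.injective_id,
      fun i => (hCR i i.2).1, fun i => (hCR i i.2).2⟩, I.connected, Iff.rfl, by simp⟩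
  · rintro s' t ⟨ht, h10, -, -, m, C, R, e, -, hs, hrep, hconn, hiff, hno⟩
    rw [halts_block_nil]
    refine ⟨?_, m, C, R, e, hs, hrep, hconn, hiff, hno h10⟩
    have h1 : (I.n + 1) ^ 3 ≤ (I.n + 2) ^ 3 := by gcongr; omega
    have h2 : (I.n + 2) * (300 * (I.n + 1) ^ 3 + 11) ≤ (I.n + 2) * (300 * (I.n + 2) ^ 3 + 11) := by
      gcongr
    have h3 : (I.n + 2) * (300 * (I.n + 2) ^ 3 + 11) = 300 * (I.n + 2) ^ 4 + 11 * (I.n + 2) := by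
      ring
    have h4 : I.n + 2 ≤ (I.n + 2) ^ 4 := Nat.le_self_pow (by omega) _
    have h5 : (I.n + 1 + 1) * (300 * (I.n + 1) ^ 3 + 10 + 1)
        = (I.n + 2) * (300 * (I.n + 1) ^ 3 + 11) := by ring
    omega

/-! ### Writing the output -/

/-- If there is no cop, or one cop and more than one vertex, replace the instance by a vertex with
no cop on it. -/
def settle : Prog :=
  .ite 5 .skip (.ite 3 (block [.sub 22 4 1, .ite 22 (block [.const 4 1, .const 3 0]) .skip])
    (block [.const 4 1, .const 3 0]))

theorem halts_settle (h : Ctx A C R k m s) (hm : 1 ≤ m) :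
    Halts settle s fun s' t => t ≤ 10 ∧ ∃ k' m', Ctx A C R k' m' s' ∧
      ((k' = k ∧ m' = m ∧ (2 ≤ k ∨ k = 1 ∧ m = 1)) ∨
        (k' = 0 ∧ m' = 1 ∧ (k = 0 ∨ k = 1 ∧ 2 ≤ m))) := by
  have hno : k - 1 = 0 → ∀ s', Agree s s' → Ctx A C R 0 1 ((s'.setReg 4 1).setReg 3 0) := by
    intro hk s' ha
    have h' := h.agree ha
    refine ⟨?_, ?_, ?_, ?_, ?_, ?_, ?_, ?_⟩ <;>
      simp [h'.reg_one, h'.reg_pred, h'.reg_zero, h'.arr_input, h'.arr_col, h'.arr_row, hk]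
  simp only [settle, halts_ite, halts_skip, halts_block_cons, halts_block_nil, halts_const,
    halts_sub, h.reg_pred, h.reg_k, h.reg_m, h.reg_one]
  split_ifs with h1 h2 h3
  · exact ⟨by omega, 0, 1, hno h1 s (.refl s), by omega⟩
  · simp at h3
    exact ⟨by omega, k, m, h.setReg (by omega), by omega⟩
  · simp at h3
    exact ⟨by omega, 0, 1, hno h1 _ ((Agree.refl s).setReg (by omega)), by omega⟩
  · exact ⟨by omega, k, m, h, by omega⟩

/-- Write the instance with the current graph and at most as many cops as vertices to the
output. -/
def write : Prog :=
  block [.sub 22 3 4, .sub 16 3 22, .store 1 6 4, .store 1 1 16, .const 0 2, .add 11 4 6,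
    countdown 11 (.add 0 0 4), .add 16 0 6, .add 11 4 6,
    countdown 11 (block [.add 12 4 6, countdown 12 (block [lookup 11 12, .sub 16 16 1,
      .store 1 16 24])])]

theorem Ctx.store (h : Ctx A C R k m s) {i v : ℕ} : Ctx A C R k m (s.setArr 1 i v) := by
  refine ⟨h.reg_one, h.reg_k, h.reg_m, h.reg_pred, h.reg_zero, ?_, ?_, ?_⟩ <;>
    simp [h.arr_input, h.arr_col, h.arr_row]

/-- What has been written when the bits from the `i`-th on, in the order of the output, are
done. -/
structure Written (A C R : ℕ → ℕ) (k m i : ℕ) (s : State) : Prop where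
  ctx : Ctx A C R k m s
  len : s.reg 0 = 2 + m * m
  pointer : s.reg 16 = 2 + i
  vertices : s.arr 1 0 = m
  cops : s.arr 1 1 = min k m
  bits : ∀ q < m * m, i ≤ q → s.arr 1 (2 + q) = bit A C R (q / m) (q % m)

theorem Written.setReg {i : ℕ} (h : Written A C R k m i s) {x v : ℕ} (hx : 7 ≤ x) (hx' : x ≠ 16) :
    Written A C R k m i (s.setReg x v) := by
  refine ⟨h.ctx.setReg hx, ?_, ?_, h.vertices, h.cops, h.bits⟩ <;>
    rw [State.setReg_reg, if_neg (by omega)]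
  exacts [h.len, h.pointer]

theorem Written.agree {i : ℕ} (h : Written A C R k m i s) {s' : State} (ha : Agree s s') :
    Written A C R k m i s' := by
  refine ⟨h.ctx.agree ha, ?_, ?_, ?_, ?_, ?_⟩ <;>
    first | rw [ha.2] | rw [ha.1 _ (by omega)]
  exacts [h.len, h.pointer, h.vertices, h.cops, h.bits]

theorem halts_writeBit {i j : ℕ} (hj : j < m) (h : Written A C R k m (i * m + j + 1) s)
    (h11 : s.reg 11 = i) (h12 : s.reg 12 = j) :
    Halts (block [lookup 11 12, .sub 16 16 1, .store 1 16 24]) s fun s' t => t ≤ 10 ∧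
      Written A C R k m (i * m + j) s' ∧ s'.reg 11 = i ∧ s'.reg 12 = j := by
  rw [halts_block_cons]
  refine halts_lookup h.ctx (by omega) fun s₁ ha₁ hb₁ => ?_
  have h₁ := h.agree ha₁
  have hp : s₁.reg 16 - s₁.reg 1 = 2 + (i * m + j) := by
    rw [h₁.pointer, h₁.ctx.reg_one]; omega
  rw [h11, h12] at hb₁
  simp only [halts_block_cons, halts_block_nil, halts_sub, halts_store]
  refine ⟨by omega, ⟨(h₁.ctx.setReg (by omega)).store, ?_, ?_, ?_, ?_, fun q hq hiq => ?_⟩, ?_, ?_⟩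
  · simpa using h₁.len
  · simpa using hp
  · simp only [State.setArr_arr, State.setReg_reg, State.setReg_arr, reduceIte, hp]
    rw [Function.update_of_ne (by omega), h₁.vertices]
  · simp only [State.setArr_arr, State.setReg_reg, State.setReg_arr, reduceIte, hp]
    rw [Function.update_of_ne (by omega), h₁.cops]
  · simp only [State.setArr_arr, State.setReg_reg, State.setReg_arr, reduceIte, hp,
      Nat.reduceEqDiff, hb₁]
    rcases hiq.eq_or_lt with rfl | hiq
    · have hm : 0 < m := by omega
      rw [Function.update_self, Nat.mul_comm i m, Nat.mul_add_div hm, Nat.div_eq_of_lt hj,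
        Nat.mul_add_mod, Nat.mod_eq_of_lt hj, Nat.add_zero]
    · rw [Function.update_of_ne (by omega), h₁.bits q hq (by omega)]
  · simpa [h11] using ha₁.1 11 (by omega)
  · simpa [h12] using ha₁.1 12 (by omega)

theorem halts_write (h : Ctx A C R k m s) :
    Halts write s fun s' t => t ≤ 100 * (m + 1) ^ 2 ∧ Written A C R k m 0 s' := by
  simp only [write, halts_block_cons, halts_block_nil, halts_sub, halts_store, halts_const,
    halts_add]
  -- The bits are written from the last to the first, so their number `m * m` is computed before.
  refine (halts_countdown (Inv := fun i s' => Ctx A C R k m s' ∧ s'.reg 11 = i ∧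
    s'.reg 0 + i * m = 2 + m * m ∧ s'.arr 1 0 = m ∧ s'.arr 1 1 = min k m) (T := 1)
    (fun i s' hi => ⟨hi.2.1, hi.1.reg_one⟩) (m := m) ?_ ?_).imp ?_
  · rintro i hi s₀ ⟨h₀, -, h0, hv, hc⟩
    rw [halts_add]
    refine ⟨le_rfl, ⟨?_, ?_, ?_, ?_, ?_, h₀.arr_input, h₀.arr_col, h₀.arr_row⟩, ?_, ?_, hv, hc⟩ <;>
      simp [h₀.reg_one, h₀.reg_k, h₀.reg_m, h₀.reg_pred, h₀.reg_zero]
    rw [← h0]; ring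
  · refine ⟨⟨?_, ?_, ?_, ?_, ?_, ?_, ?_, ?_⟩, ?_, ?_, ?_, ?_⟩ <;>
      simp [h.reg_one, h.reg_k, h.reg_m, h.reg_pred, h.reg_zero, h.arr_input, h.arr_col, h.arr_row]
    omega
  rintro s₁ t₁ ⟨ht₁, h₁, h11₁, h0₁, hv₁, hc₁⟩
  have hW : Written A C R k m (m * m) ((s₁.setReg 16 (s₁.reg 0 + s₁.reg 6)).setReg 11
      ((s₁.setReg 16 (s₁.reg 0 + s₁.reg 6)).reg 4 + (s₁.setReg 16 (s₁.reg 0 + s₁.reg 6)).reg 6)) := by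
    refine ⟨(h₁.setReg (by omega)).setReg (by omega), ?_, ?_, hv₁, hc₁, fun q hq hq' => by omega⟩ <;>
      simp [h₁.reg_zero] <;> omega
  refine (halts_countdown (Inv := fun i s' => Written A C R k m (i * m) s' ∧ s'.reg 11 = i)
    (T := (m + 1) * 12 + 3) (fun i s' hi => ⟨hi.2, hi.1.ctx.reg_one⟩) (m := m) ?_ ⟨hW, ?_⟩).imp ?_
  · rintro i hi s₂ ⟨h₂, -⟩
    simp only [halts_block_cons, halts_block_nil, halts_add]
    refine (halts_countdown (Inv := fun j s' => Written A C R k m (i * m + j) s' ∧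
      s'.reg 11 = i ∧ s'.reg 12 = j) (T := 10) (fun j s' hj => ⟨hj.2.2, hj.1.ctx.reg_one⟩)
      (m := m) ?_ ⟨?_, ?_, ?_⟩).imp ?_
    · rintro j hj s₃ ⟨h₃, h11₃, -⟩
      exact halts_writeBit hj (h₃.setReg (by omega) (by omega)) (by simpa using h11₃) (by simp)
    · rw [← Nat.succ_mul]
      exact (h₂.setReg (by omega) (by omega)).setReg (by omega) (by omega)
    · simp
    · simp [h₂.ctx.reg_m, h₂.ctx.reg_zero]
    · rintro s₃ t₃ ⟨ht₃, h₃, h11₃, -⟩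
      exact ⟨by omega, h₃, h11₃⟩
  · simp [h₁.reg_m, h₁.reg_zero]
  · rintro s₂ t₂ ⟨ht₂, h₂, -⟩
    rw [Nat.zero_mul] at h₂
    refine ⟨?_, h₂⟩
    nlinarith

/-- The whole kernelization. -/
def kernelize : Prog :=
  block [setup, reduce, settle, write]

theorem hasOutput_of_written {I : Instance} {e : Fin m → Fin I.n}
    (hW : Written (fun i => I.encode.getD i 0) C R k m 0 s) (hrep : Represents I e C R)
    (J : Instance) (hn : J.n = m) (hk : J.k = min k m)
    (hadj : ∀ i j, J.graph.Adj i j ↔ (I.graph.comap e).Adj (i.cast hn) (j.cast hn)) :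
    HasOutput s J.encode := by
  classical
  subst hn
  rw [HasOutput, J.length_encode, Nat.add_comm]
  refine ⟨hW.len, fun i hi => ?_⟩
  obtain _ | _ | q := i
  · exact hW.vertices
  · rw [hW.cops, ← hk]; rfl
  · have hq : q < J.n * J.n := by omega
    have hn : 0 < J.n := Nat.pos_of_mul_pos_left (Nat.zero_lt_of_lt hq)
    have h1 := J.getD_encode ⟨q / J.n, Nat.div_lt_of_lt_mul hq⟩ ⟨q % J.n, Nat.mod_lt _ hn⟩
    have h2 := hrep.bit_eq ⟨q / J.n, Nat.div_lt_of_lt_mul hq⟩ ⟨q % J.n, Nat.mod_lt _ hn⟩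
    simp only [Nat.div_add_mod'] at h1
    rw [show q + 1 + 1 = 2 + q by omega, h1, hW.bits q hq (Nat.zero_le q), h2]
    simp only [hadj]
    rfl

/-- On every instance, the program writes an equivalent instance with no more cops than vertices,
whose number of vertices obeys the bound that Sperner's theorem gives. -/
theorem exists_kernel (I : Instance) : ∃ J : Instance,
    (Halts kernelize (RAM.input I.encode) fun s t =>
      t ≤ 2000 * (I.n + 2) ^ 4 ∧ HasOutput s J.encode) ∧
    (IsCopwin I.graph I.k ↔ IsCopwin J.graph J.k) ∧ J.k ≤ J.n ∧
    J.n ≤ vcn I.graph + (vcn I.graph).choose (vcn I.graph / 2) := by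
  have hn : 1 ≤ I.n := Fin.pos (Classical.choice I.connected.nonempty)
  suffices h : Halts kernelize (RAM.input I.encode) fun s t => t ≤ 2000 * (I.n + 2) ^ 4 ∧
      ∃ J : Instance, HasOutput s J.encode ∧
        (IsCopwin I.graph I.k ↔ IsCopwin J.graph J.k) ∧ J.k ≤ J.n ∧
        J.n ≤ vcn I.graph + (vcn I.graph).choose (vcn I.graph / 2) by
    obtain ⟨t, s, hr, ht, J, hJ, h⟩ := h
    exact ⟨J, ⟨t, s, hr, ht, hJ⟩, h⟩
  rw [kernelize, halts_block_cons]
  refine (halts_setup I).imp ?_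
  rintro s₁ t₁ ⟨ht₁, C, R, h₁, hCR⟩
  rw [halts_block_cons]
  refine (halts_reduce h₁ hCR).imp ?_
  rintro s₂ t₂ ⟨ht₂, m, C, R, e, h₂, hrep, hconn, hiff, hno⟩
  have : Nonempty (Fin m) := hconn.nonempty
  have hm : 1 ≤ m := Fin.pos (Classical.arbitrary _)
  have hmn : m ≤ I.n := by simpa using Fintype.card_le_of_injective e hrep.inj
  have hchoose : 1 ≤ (vcn I.graph).choose (vcn I.graph / 2) :=
    Nat.choose_pos (Nat.div_le_self _ _)
  rw [halts_block_cons]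
  refine (halts_settle h₂ hm).imp ?_
  rintro s₃ t₃ ⟨ht₃, k', m', h₃, hcases⟩
  rw [halts_block_cons]
  refine (halts_write h₃).imp ?_
  rintro s₄ t₄ ⟨ht₄, hW⟩
  rw [halts_block_nil]
  have hm' : m' ≤ I.n := by omega
  constructor
  · have h1 : (m' + 1) ^ 2 ≤ (I.n + 2) ^ 2 := by gcongr; omega
    have h2 : (I.n + 2) ^ 2 ≤ (I.n + 2) ^ 4 := Nat.pow_le_pow_right (by omega) (by omega)
    have h3 : I.n + 2 ≤ (I.n + 2) ^ 4 := Nat.le_self_pow (by omega) _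
    omega
  rcases hcases with ⟨rfl, rfl, hk⟩ | ⟨rfl, rfl, hk⟩
  · refine ⟨⟨m', I.graph.comap e, hconn, min I.k m'⟩,
      hasOutput_of_written hW hrep _ rfl rfl fun i j => Iff.rfl,
      hiff.trans isCopwin_min_iff.symm, min_le_right _ _, ?_⟩
    rcases hk with hk | ⟨-, rfl⟩
    · have := card_le_vcn_add_choose hrep.inj fun u v hd => hno u v ⟨hd, fun h => by omega⟩
      rwa [Nat.card_fin] at this
    · change 1 ≤ _
      omega
  -- The negative instances: the first of the remaining vertices, and no cop.
  · have hrep' : Represents I (fun i : Fin 1 => e (i.castLE hm)) C R :=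
      ⟨hrep.inj.comp (Fin.castLE_injective hm), fun i => hrep.col (i.castLE hm),
        fun i => hrep.row (i.castLE hm)⟩
    refine ⟨⟨1, I.graph.comap fun i : Fin 1 => e (i.castLE hm),
      SimpleGraph.Connected.of_subsingleton, 0⟩,
      hasOutput_of_written hW hrep' _ rfl (by simp) fun i j => Iff.rfl,
      iff_of_false ?_ not_isCopwin_zero, Nat.zero_le _, ?_⟩
    · rw [hiff]
      rcases hk with hk | ⟨hk, hm2⟩
      · rw [hk]; exact not_isCopwin_zero
      · have : Nontrivial (Fin m) := Fin.nontrivial_iff_two_le.2 hm2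
        rw [hk]
        refine not_isCopwin_one fun u v huv => ?_
        by_contra! hc
        exact hno u v ⟨⟨huv.ne, hc⟩, fun _ => huv⟩
    · change 1 ≤ _
      omega

end CopsRobber

theorem theorem2 :
    ∃ f : CopsRobber.Instance → CopsRobber.Instance,
      CopsRobber.problemVcn.IsKernelization f ∧
        ∀ I : CopsRobber.Instance, 1 ≤ CopsRobber.vcn I.graph →
          ((f I).n : ℝ) ≤ (CopsRobber.vcn I.graph : ℝ) +
            (2 : ℝ) ^ CopsRobber.vcn I.graph / Real.sqrt (CopsRobber.vcn I.graph : ℝ) := by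
  choose f hhalts hiff hk hn using CopsRobber.exists_kernel
  refine ⟨f, ⟨?_, hiff, CopsRobber.sizeBound, CopsRobber.computable_sizeBound, fun I => ?_⟩,
    fun I hI => ?_⟩
  · refine ⟨CopsRobber.kernelize, 2000 * (Polynomial.X + 2) ^ 4, fun I => ?_⟩
    obtain ⟨t, s, hr, ht, hout⟩ := hhalts I
    refine ⟨t, s, hr, hout, ht.trans ?_⟩
    have h1 := I.length_le_size
    rw [I.length_encode] at h1
    have h2 : I.n ≤ I.n * I.n := Nat.le_mul_self _
    simp only [Polynomial.eval_mul, Polynomial.eval_pow, Polynomial.eval_add, Polynomial.eval_X,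
      Polynomial.eval_ofNat]
    gcongr
    omega
  · have h1 : (f I).n ≤ CopsRobber.vcn I.graph + 2 ^ CopsRobber.vcn I.graph :=
      (hn I).trans (Nat.add_le_add_left (Nat.choose_le_two_pow _ _) _)
    refine ((f I).size_le (hk I)).trans ?_
    change _ ≤ CopsRobber.sizeBound (CopsRobber.vcn I.graph)
    unfold CopsRobber.sizeBound
    gcongr
  · have h1 : ((f I).n : ℝ) ≤ CopsRobber.vcn I.graph +
        (CopsRobber.vcn I.graph).choose (CopsRobber.vcn I.graph / 2) := by exact_mod_cast hn I
    linarith [CopsRobber.choose_half_le hI]
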